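/- Let $\mathbb K$ be $\mathbb R$ or $\mathbb C$, let $A$ be a (not necessarily unital) Banach algebra over $\mathbb K$ with a bounded approximate left identity, $G$ a locally compact Hausdorff group with a fixed left Haar measure $ds$, and $\alpha$ a strongly continuous action of $G$ on $A$ by bounded automorphisms. The space $C_c(G,A)$ carries the twisted convolution $[f*g](s)=\int_G f(r)\,\alpha_r(g(r^{-1}s))\,dr$. A continuous covariant representation of $(A,G,\alpha)$ in a Banach space $X$ is a pair $(\pi,U)$ of a bounded algebra homomorphism $\pi:A\to B(X)$ and a strongly continuous homomorphism $U$ from $G$ to the invertible operators on $X$, with $\pi(\alpha_s(a))=U_s\pi(a)U_s^{-1}$ for all $a\in A$, $s\in G$. It is non-degenerate if $\mathrm{span}\,\pi(A)X$ is dense in $X$. Its integrated form is $\pi\rtimes U(f)=\int_G\pi(f(s))U_s\,ds$ for $f\in C_c(G,A)$. Let $\mathcal R$ be a non-empty class of non-degenerate continuous covariant representations that is uniformly bounded: there are $C\ge 0$ and a function $\nu:G\to[0,\infty)$, bounded on compact sets, with $\|\pi\|\le C$ and $\|U_r\|\le\nu(r)$ for all $(\pi,U)\in\mathcal R$ and $r\in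 G$. Put $\sigma^{\mathcal R}(f)=\sup_{(\pi,U)\in\mathcal R}\|\pi\rtimes U(f)\|$ and $\nu^{\mathcal R}(r)=\sup_{(\pi,U)\in\mathcal R}\|U_r\|$. Let $(A\rtimes_\alpha G)^{\mathcal R}$ be the Banach algebra obtained by completing $C_c(G,A)/\ker\sigma^{\mathcal R}$ in the norm induced by $\sigma^{\mathcal R}$, and let $q^{\mathcal R}$ be the canonical map from $C_c(G,A)$ into it. A continuous covariant representation $(\pi,U)$ in $X$ is $\mathcal R$-continuous if $\|\pi\rtimes U(f)\|\le C'\sigma^{\mathcal R}(f)$ for all $f$ and some constant $C'$; then $(\pi\rtimes U)^{\mathcal R}$ denotes the unique bounded representation of $(A\rtimes_\alpha G)^{\mathcal R}$ in $X$ with $(\pi\rtimes U)^{\mathcal R}(q^{\mathcal R}(f))=\pi\rtimes U(f)$ for all $f$. Assume that there are constants $D,C_1\ge 0$ such that $\nu^{\mathcal R}(r)\le D$ for all $r\in G$, and $\|f\|_{L^1(G,A)}\le C_1\sigma^{\mathcal R}(f)$ for all $f\in C_c(G,A)$. Let $\mathcal X$ be a class of Banach spaces over $\mathbb K$. (i)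 Every non-degenerate continuous covariant representation $(\pi,U)$ of $(A,G,\alpha)$ in a space from $\mathcal X$ for which there is a constant $C_U$ with $\|U_r\|\le C_U$ for all $r\in G$ is $\mathcal R$-continuous, and the map $(\pi,U)\mapsto(\pi\rtimes U)^{\mathcal R}$ is a bijection from the class of these covariant representations onto the class of all non-degenerate bounded representations of $(A\rtimes_\alpha G)^{\mathcal R}$ in spaces from $\mathcal X$. (ii) This map preserves the set of closed invariant subspaces of an element of its domain, and the space of bounded intertwining operators between two elements of its domain. (iii) The Banach algebra $(A\rtimes_\alpha G)^{\mathcal R}$ is isomorphic (as a topological algebra) to $L^1(G,A)$ with twisted convolution, by an isomorphism that sends the class of $f\in C_c(G,A)$ to $q^{\mathcal R}(f)$. (iv) Suppose that $A$ has a bounded involution, that every $\alpha_s$ preserves it, and that every $(\pi,U)\in\mathcal R$ is involutive, i.e. its space is a Hilbert space, $\pi(a^*)=\pi(a)^*$ for all $a\in A$, and all $U_s$ are unitary. Let $\Delta$ be the modular function, so that $\Delta(r)\int_G f(sr)\,ds=\int_G f(s)\,ds$, and put $f^*(s)=\Delta(s^{-1})\,\alpha_s(f(s^{-1})^*)$ for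 $f\in C_c(G,A)$. Then $(A\rtimes_\alpha G)^{\mathcal R}$ has an involution with $q^{\mathcal R}(f)^*=q^{\mathcal R}(f^*)$ that satisfies the $C^*$-identity, and a covariant representation $(\pi,U)$ in the domain of the bijection is involutive if and only if $(\pi\rtimes U)^{\mathcal R}$ is a $*$-representation in a Hilbert space. -/

import Mathlib

open MeasureTheory Filter Topology
open scoped CompactlySupported NNReal

namespace CrossedProd

noncomputable section

set_option linter.unusedSectionVars false

universe u v w

/-! ## Banach spaces as objects -/

/-- A Banach space over `𝕜`, as an object, so that one can speak about classes of Banach spaces. -/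
structure BanachSpace (𝕜 : Type u) [RCLike 𝕜] : Type (max u (v + 1)) where
  carrier : Type v
  normedAddCommGroup : NormedAddCommGroup carrier
  normedSpace : NormedSpace 𝕜 carrier
  completeSpace : CompleteSpace carrier

instance (𝕜 : Type u) [RCLike 𝕜] : CoeSort (BanachSpace.{u, v} 𝕜) (Type v) :=
  ⟨BanachSpace.carrier⟩

attribute [instance] BanachSpace.normedAddCommGroup BanachSpace.normedSpace
  BanachSpace.completeSpace

/-- The underlying real Banach space, used for Bochner integrals. -/
instance (𝕜 : Type u) [RCLike 𝕜] (X : BanachSpace.{u, v} 𝕜) : NormedSpace ℝ X :=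
  NormedSpace.restrictScalars ℝ 𝕜 X

instance (𝕜 : Type u) [RCLike 𝕜] (X : BanachSpace.{u, v} 𝕜) : IsScalarTower ℝ 𝕜 X :=
  IsScalarTower.restrictScalars ℝ 𝕜 X

/-! ## Banach algebra dynamical systems -/

/-- The system `(A, G, α)`: a strongly continuous action `α` of the group `G` on the normed algebra
`A` by bounded automorphisms. (`α s` has the bounded inverse `α s⁻¹`.) -/
structure DynSystem (𝕜 : Type*) [RCLike 𝕜] (A : Type*) [NonUnitalNormedRing A] [NormedSpace 𝕜 A]
    (G : Type*) [Group G] [TopologicalSpace G] where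
  act : G →* (A →L[𝕜] A)
  act_mul : ∀ s a b, act s (a * b) = act s a * act s b
  continuous_act : ∀ a, Continuous fun s => act s a

/-- `A` has a bounded approximate left identity: a net, here presented by the filter of its tails,
that is bounded and satisfies `u_i a → a` for all `a`. -/
def HasBoundedApproxLeftIdentity (A : Type*) [NonUnitalNormedRing A] : Prop :=
  ∃ l : Filter A, l.NeBot ∧ (∃ M : ℝ, ∀ᶠ x in l, ‖x‖ ≤ M) ∧
    ∀ a : A, Tendsto (fun x => x * a) l (𝓝 a)

/-- A family of operators is non-degenerate if the linear span of all `τ b x` is dense. -/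
def NonDegenerate {𝕜 : Type*} [RCLike 𝕜] {B X : Type*} [NormedAddCommGroup X] [NormedSpace 𝕜 X]
    (τ : B → X →L[𝕜] X) : Prop :=
  Dense (Submodule.span 𝕜 {y : X | ∃ b x, y = τ b x} : Set X)

/-! ## Strongly continuous group representations -/

section StronglyContinuous

variable {𝕜 : Type*} [RCLike 𝕜] {G : Type*} [Group G] [TopologicalSpace G]
  {X : Type*} [NormedAddCommGroup X] [NormedSpace 𝕜 X] [CompleteSpace X]

theorem exists_bound_of_isCompact (V : G →* (X →L[𝕜] X)) (hV : ∀ x, Continuous fun s => V s x)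
    {K : Set G} (hK : IsCompact K) : ∃ C : ℝ, 0 ≤ C ∧ ∀ s ∈ K, ‖V s‖ ≤ C := by
  obtain ⟨C, hC⟩ := banach_steinhaus (g := fun s : K => V s) (fun x => by
    obtain ⟨C, hC⟩ := hK.exists_bound_of_continuousOn (hV x).continuousOn
    exact ⟨C, fun s => hC s s.2⟩)
  exact ⟨max C 0, le_max_right _ _, fun s hs => (hC ⟨s, hs⟩).trans (le_max_left _ _)⟩

theorem continuous_uncurry_of_strong [LocallyCompactSpace G] (V : G →* (X →L[𝕜] X))
    (hV : ∀ x, Continuous fun s => V s x) : Continuous fun p : G × X => V p.1 p.2 := by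
  rw [continuous_iff_continuousAt]
  rintro ⟨r, x⟩
  obtain ⟨K, hK, hr⟩ := exists_compact_mem_nhds r
  obtain ⟨C, -, hC⟩ := exists_bound_of_isCompact V hV hK
  have h1 : Tendsto (fun p : G × X => V p.1 (p.2 - x)) (𝓝 (r, x)) (𝓝 0) := by
    have hlim : Tendsto (fun p : G × X => C * ‖p.2 - x‖) (𝓝 (r, x)) (𝓝 0) := by
      have : Continuous fun p : G × X => C * ‖p.2 - x‖ := by fun_prop
      simpa using this.tendsto (r, x)
    refine squeeze_zero_norm' ?_ hlim
    have : ∀ᶠ p : G × X in 𝓝 (r, x), p.1 ∈ K := continuous_fst.continuousAt.eventually_mem hr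
    filter_upwards [this] with p hp
    exact ((V p.1).le_opNorm _).trans (by gcongr; exact hC _ hp)
  have h2 : Tendsto (fun p : G × X => V p.1 x) (𝓝 (r, x)) (𝓝 (V r x)) :=
    ((hV x).comp continuous_fst).tendsto (r, x)
  have := h1.add h2
  simpa [ContinuousAt] using this

end StronglyContinuous

section Main

variable {𝕜 : Type u} [RCLike 𝕜]
  {A : Type*} [NonUnitalNormedRing A] [NormedSpace 𝕜 A] [NormedSpace ℝ A] [IsScalarTower ℝ 𝕜 A]
  [IsScalarTower 𝕜 A A] [SMulCommClass 𝕜 A A] [CompleteSpace A]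
  {G : Type*} [Group G] [TopologicalSpace G] [IsTopologicalGroup G] [LocallyCompactSpace G]
  [T2Space G] [MeasurableSpace G] [BorelSpace G]

/-! ## Twisted convolution on `C_c(G, A)` -/

section Convolution

variable (S : DynSystem 𝕜 A G)

theorem DynSystem.continuous_uncurry : Continuous fun p : G × A => S.act p.1 p.2 :=
  continuous_uncurry_of_strong S.act S.continuous_act

theorem DynSystem.continuous_comp {Z : Type*} [TopologicalSpace Z] {p : Z → G} {q : Z → A}
    (hp : Continuous p) (hq : Continuous q) : Continuous fun z => S.act (p z) (q z) :=
  S.continuous_uncurry.comp (hp.prodMk hq)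

theorem eq_zero_of_notMem_tsupport (f : C_c(G, A)) {s : G} (hs : s ∉ tsupport f) : f s = 0 :=
  image_eq_zero_of_notMem_tsupport hs

/-- The integrand of the twisted convolution. -/
def convKernel (f g : G → A) (s r : G) : A := f r * S.act r (g (r⁻¹ * s))

theorem continuous_convKernel (f g : C_c(G, A)) :
    Continuous (Function.uncurry (convKernel S f g)) := by
  have := S.continuous_comp (Z := G × G) (p := fun z => z.2) (q := fun z => g (z.2⁻¹ * z.1))
    (by fun_prop) (by fun_prop)
  unfold convKernel Function.uncurry
  fun_prop

theorem hasCompactSupport_convKernel (f g : C_c(G, A)) (s : G) :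
    HasCompactSupport (convKernel S f g s) :=
  HasCompactSupport.intro f.hasCompactSupport fun r hr => by
    simp [convKernel, eq_zero_of_notMem_tsupport f hr]

theorem integrable_convKernel (μ : Measure G) [μ.IsHaarMeasure] (f g : C_c(G, A)) (s : G) :
    Integrable (convKernel S f g s) μ :=
  ((continuous_convKernel S f g).comp (by fun_prop : Continuous fun r => (s, r))
    ).integrable_of_hasCompactSupport (hasCompactSupport_convKernel S f g s)

/-- The twisted convolution `[f * g](s) = ∫ f(r) α_r(g(r⁻¹s)) dr`, for functions `G → A`. -/
def twistedConvFun (μ : Measure G) (f g : G → A) (s : G) : A := ∫ r, f r * S.act r (g (r⁻¹ * s)) ∂μ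

/-- The twisted convolution on `C_c(G, A)`. -/
def twistedConv (μ : Measure G) [μ.IsHaarMeasure] (f g : C_c(G, A)) : C_c(G, A) where
  toFun := twistedConvFun S μ f g
  continuous_toFun := by
    rw [← continuousOn_univ]
    exact continuousOn_integral_of_compact_support (f := convKernel S f g) f.hasCompactSupport
      (continuous_convKernel S f g).continuousOn
      fun s r _ hr => by simp [convKernel, eq_zero_of_notMem_tsupport f hr]
  hasCompactSupport' :=
    HasCompactSupport.intro (f.hasCompactSupport.isCompact.mul g.hasCompactSupport.isCompact)
      fun s hs => by
        have : ∀ r, f r * S.act r (g (r⁻¹ * s)) = 0 := fun r => by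
          by_cases hr : r ∈ tsupport f
          · have : r⁻¹ * s ∉ tsupport g := fun h =>
              hs (Set.mem_mul.2 ⟨r, hr, r⁻¹ * s, h, by group⟩)
            simp [eq_zero_of_notMem_tsupport g this]
          · simp [eq_zero_of_notMem_tsupport f hr]
        simp [twistedConvFun, this]

theorem twistedConv_apply (μ : Measure G) [μ.IsHaarMeasure] (f g : C_c(G, A)) (s : G) :
    twistedConv S μ f g s = ∫ r, convKernel S f g s r ∂μ := rfl

theorem twistedConv_assoc (μ : Measure G) [μ.IsHaarMeasure] (f g h : C_c(G, A)) :
    twistedConv S μ (twistedConv S μ f g) h = twistedConv S μ f (twistedConv S μ g h) := by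
  ext s
  let F : G → G → A := fun r t => f t * S.act t (g (t⁻¹ * r)) * S.act r (h (r⁻¹ * s))
  have hFc : Continuous F.uncurry := by
    have h1 := (continuous_convKernel S f g)
    have h2 := S.continuous_comp (Z := G × G) (p := fun z => z.1) (q := fun z => h (z.1⁻¹ * s))
      (by fun_prop) (by fun_prop)
    exact h1.mul h2
  have hFs : HasCompactSupport F.uncurry := by
    refine HasCompactSupport.intro
      ((f.hasCompactSupport.isCompact.mul g.hasCompactSupport.isCompact).prod
        f.hasCompactSupport.isCompact) ?_
    rintro ⟨r, t⟩ hrt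
    by_cases ht : t ∈ tsupport f
    · have : t⁻¹ * r ∉ tsupport g := fun hh =>
        hrt ⟨Set.mem_mul.2 ⟨t, ht, t⁻¹ * r, hh, by group⟩, ht⟩
      simp [F, Function.uncurry, eq_zero_of_notMem_tsupport g this]
    · simp [F, Function.uncurry, eq_zero_of_notMem_tsupport f ht]
  calc twistedConv S μ (twistedConv S μ f g) h s
      = ∫ r, ∫ t, F r t ∂μ ∂μ := by
        rw [twistedConv_apply]
        refine integral_congr_ae (.of_forall fun r => ?_)
        exact (ContinuousLinearMap.integral_comp_comm
          ((ContinuousLinearMap.mul 𝕜 A).flip (S.act r (h (r⁻¹ * s))))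
          (integrable_convKernel S μ f g r)).symm
    _ = ∫ t, ∫ r, F r t ∂μ ∂μ := integral_integral_swap_of_hasCompactSupport hFc hFs
    _ = ∫ t, ∫ r, F (t * r) t ∂μ ∂μ := by
        refine integral_congr_ae (.of_forall fun t => ?_)
        exact (integral_mul_left_eq_self (fun r => F r t) t).symm
    _ = ∫ t, f t * S.act t (∫ r, convKernel S g h (t⁻¹ * s) r ∂μ) ∂μ := by
        refine integral_congr_ae (.of_forall fun t => ?_)
        have hi := integrable_convKernel S μ g h (t⁻¹ * s)
        have := ContinuousLinearMap.integral_comp_comm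
          ((ContinuousLinearMap.mul 𝕜 A (f t)).comp (S.act t)) hi
        simp only [ContinuousLinearMap.comp_apply, ContinuousLinearMap.mul_apply'] at this
        simp only
        rw [← this]
        refine integral_congr_ae (.of_forall fun r => ?_)
        simp [F, convKernel, S.act_mul, mul_assoc]
    _ = _ := rfl

theorem twistedConv_add_right (μ : Measure G) [μ.IsHaarMeasure] (f g h : C_c(G, A)) :
    twistedConv S μ f (g + h) = twistedConv S μ f g + twistedConv S μ f h := by
  ext s
  rw [CompactlySupportedContinuousMap.add_apply, twistedConv_apply, twistedConv_apply,
    twistedConv_apply, ← integral_add (integrable_convKernel S μ f g s)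
    (integrable_convKernel S μ f h s)]
  simp [convKernel, mul_add]

theorem twistedConv_add_left (μ : Measure G) [μ.IsHaarMeasure] (f g h : C_c(G, A)) :
    twistedConv S μ (f + g) h = twistedConv S μ f h + twistedConv S μ g h := by
  ext s
  rw [CompactlySupportedContinuousMap.add_apply, twistedConv_apply, twistedConv_apply,
    twistedConv_apply, ← integral_add (integrable_convKernel S μ f h s)
    (integrable_convKernel S μ g h s)]
  simp [convKernel, add_mul]

theorem twistedConv_smul_right (μ : Measure G) [μ.IsHaarMeasure] (c : 𝕜) (f g : C_c(G, A)) :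
    twistedConv S μ f (c • g) = c • twistedConv S μ f g := by
  ext s
  rw [CompactlySupportedContinuousMap.smul_apply, twistedConv_apply, twistedConv_apply,
    ← integral_smul]
  simp [convKernel, mul_smul_comm]

theorem twistedConv_smul_left (μ : Measure G) [μ.IsHaarMeasure] (c : 𝕜) (f g : C_c(G, A)) :
    twistedConv S μ (c • f) g = c • twistedConv S μ f g := by
  ext s
  rw [CompactlySupportedContinuousMap.smul_apply, twistedConv_apply, twistedConv_apply,
    ← integral_smul]
  simp [convKernel, smul_mul_assoc]

theorem twistedConv_zero_left (μ : Measure G) [μ.IsHaarMeasure] (f : C_c(G, A)) :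
    twistedConv S μ 0 f = 0 := by
  ext s; simp [twistedConv_apply, convKernel]

theorem twistedConv_zero_right (μ : Measure G) [μ.IsHaarMeasure] (f : C_c(G, A)) :
    twistedConv S μ f 0 = 0 := by
  ext s; simp [twistedConv_apply, convKernel]

end Convolution

/-! ## The modular function and the involution on `C_c(G, A)` -/

section Involution

/-- The modular function `Δ` of `G`, normalized by `Δ(r) ∫ f(sr) ds = ∫ f(s) ds`. -/
def modularFun (r : G) : ℝ := ((Measure.modularCharacter r : ℝ≥0) : ℝ)⁻¹

theorem modularCharacter_mul_integral (μ : Measure G) [μ.IsHaarMeasure] {f : G → ℝ}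
    (hf : Continuous f) (hs : HasCompactSupport f) (r : G) :
    ((Measure.modularCharacter r : ℝ≥0) : ℝ) * ∫ s, f s ∂μ = ∫ s, f (s * r) ∂μ := by
  have h := Measure.integral_isMulLeftInvariant_eq_smul_of_hasCompactSupport
    (μ.map (· * r)) μ hf hs
  have h2 : (Measure.modularCharacter r : ℝ≥0) = Measure.haarScalarFactor (μ.map (· * r)) μ :=
    Measure.modularCharacterFun_eq_haarScalarFactor μ r
  rw [integral_map (by fun_prop) hf.aestronglyMeasurable] at h
  rw [h, h2, integral_smul_nnreal_measure]
  rfl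

theorem modularFun_mul_integral (μ : Measure G) [μ.IsHaarMeasure] {f : G → ℝ}
    (hf : Continuous f) (hs : HasCompactSupport f) (r : G) :
    modularFun r * ∫ s, f (s * r) ∂μ = ∫ s, f s ∂μ := by
  have hpos : (0 : ℝ) < (Measure.modularCharacter r : ℝ≥0) :=
    NNReal.coe_pos.2 (Measure.modularCharacterFun_pos r)
  rw [← modularCharacter_mul_integral μ hf hs, modularFun, inv_mul_cancel_left₀ hpos.ne']

theorem continuous_modularFun : Continuous (modularFun : G → ℝ) := by
  obtain ⟨⟨f, hf⟩, hs, hn, h1⟩ :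
    ∃ f : C(G, ℝ), HasCompactSupport f ∧ 0 ≤ f ∧ f 1 ≠ 0 := exists_continuous_nonneg_pos 1
  let μ : Measure G := Measure.haar
  have hpos : 0 < ∫ s, f s ∂μ :=
    hf.integral_pos_of_hasCompactSupport_nonneg_nonzero hs hn h1
  have hc : Continuous fun r : G => ∫ s, f (s * r) ∂μ := by
    rw [continuous_iff_continuousAt]
    intro r
    obtain ⟨K, hK, hr⟩ := exists_compact_mem_nhds r
    refine ContinuousOn.continuousAt (s := K) ?_ hr
    refine continuousOn_integral_of_compact_support (f := fun r s => f (s * r))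
      (hs.isCompact.mul hK.inv) (by fun_prop) fun p s hp hsn => ?_
    refine image_eq_zero_of_notMem_tsupport fun h => hsn ?_
    exact Set.mem_mul.2 ⟨s * p, h, p⁻¹, Set.inv_mem_inv.2 hp, by group⟩
  have heq : (modularFun : G → ℝ) = fun r => (∫ s, f s ∂μ) / ∫ s, f (s * r) ∂μ := by
    funext r
    have h2 := modularCharacter_mul_integral μ hf hs r
    have hm : (0 : ℝ) < (Measure.modularCharacter r : ℝ≥0) :=
      NNReal.coe_pos.2 (Measure.modularCharacterFun_pos r)
    rw [← h2, modularFun]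
    field_simp
  rw [heq]
  refine continuous_const.div hc fun r => ?_
  have hm : (0 : ℝ) < (Measure.modularCharacter r : ℝ≥0) :=
    NNReal.coe_pos.2 (Measure.modularCharacterFun_pos r)
  rw [← modularCharacter_mul_integral μ hf hs r]
  positivity

/-- The involution `f*(s) = Δ(s⁻¹) α_s(f(s⁻¹)*)` on `C_c(G, A)`, when `A` has a bounded (that is,
continuous) involution. -/
def starCc [StarRing A] [ContinuousStar A] (S : DynSystem 𝕜 A G) (f : C_c(G, A)) : C_c(G, A) where
  toFun s := modularFun s⁻¹ • S.act s (star (f s⁻¹))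
  continuous_toFun := by
    have h1 : Continuous fun s : G => S.act s (star (f s⁻¹)) :=
      S.continuous_comp continuous_id (by fun_prop)
    exact (continuous_modularFun.comp continuous_inv).smul h1
  hasCompactSupport' :=
    HasCompactSupport.intro f.hasCompactSupport.isCompact.inv fun s hs => by
      have : s⁻¹ ∉ tsupport f := fun h => hs (Set.mem_inv.2 h)
      simp [eq_zero_of_notMem_tsupport f this]

end Involution

/-! ## Continuous covariant representations and their integrated forms -/

/-- A continuous covariant representation `(π, U)` of `(A, G, α)` in the Banach space `X`: `π` is a
bounded representation of `A`, `U` a strongly continuous representation of `G` (by invertible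
operators, since `G` is a group), and `π(α_s(a)) = U_s π(a) U_s⁻¹`. -/
structure CovRep (S : DynSystem 𝕜 A G) (X : BanachSpace.{u, v} 𝕜) where
  π : A →L[𝕜] (X →L[𝕜] X)
  π_mul : ∀ a b, π (a * b) = π a * π b
  U : G →* (X →L[𝕜] X)
  continuous_U : ∀ x, Continuous fun s => U s x
  covariant : ∀ s a, π (S.act s a) = U s * π a * U s⁻¹

namespace CovRep

variable {S : DynSystem 𝕜 A G} {X : BanachSpace.{u, v} 𝕜} (ρ : CovRep S X)

theorem covariant_apply (s : G) (a : A) (x : X) : ρ.π (S.act s a) (ρ.U s x) = ρ.U s (ρ.π a x) := by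
  rw [ρ.covariant]
  have h : ρ.U s⁻¹ * ρ.U s = 1 := by rw [← map_mul, inv_mul_cancel, map_one]
  have hx : ρ.U s⁻¹ (ρ.U s x) = x := congrArg (fun L : X →L[𝕜] X => L x) h
  simp only [mul_apply_eq_comp, hx]

theorem continuous_comp {Z : Type*} [TopologicalSpace Z] {p : Z → G} {q : Z → A} {y : Z → X}
    (hp : Continuous p) (hq : Continuous q) (hy : Continuous y) :
    Continuous fun z => ρ.π (q z) (ρ.U (p z) (y z)) :=
  (ρ.π.continuous.comp hq).clm_apply
    ((continuous_uncurry_of_strong ρ.U ρ.continuous_U).comp (hp.prodMk hy))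

theorem integrable (μ : Measure G) [μ.IsHaarMeasure] (f : C_c(G, A)) (x : X) :
    Integrable (fun s => ρ.π (f s) (ρ.U s x)) μ :=
  (ρ.continuous_comp continuous_id f.continuous continuous_const).integrable_of_hasCompactSupport
    (HasCompactSupport.intro f.hasCompactSupport fun s hs => by
      simp [eq_zero_of_notMem_tsupport f hs])

theorem norm_integral_le (μ : Measure G) [μ.IsHaarMeasure] (f : C_c(G, A)) {C M : ℝ} (hC : 0 ≤ C)
    (hπ : ‖ρ.π‖ ≤ C) (hM : ∀ s ∈ tsupport f, ‖ρ.U s‖ ≤ M) (x : X) :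
    ‖∫ s, ρ.π (f s) (ρ.U s x) ∂μ‖ ≤ C * M * (∫ s, ‖f s‖ ∂μ) * ‖x‖ := by
  have hi : Integrable (fun s => ‖f s‖) μ :=
    (f.continuous.integrable_of_hasCompactSupport f.hasCompactSupport).norm
  calc ‖∫ s, ρ.π (f s) (ρ.U s x) ∂μ‖ ≤ ∫ s, C * M * ‖x‖ * ‖f s‖ ∂μ := by
        refine norm_integral_le_of_norm_le (hi.const_mul _) (.of_forall fun s => ?_)
        by_cases hs : s ∈ tsupport f
        · calc ‖ρ.π (f s) (ρ.U s x)‖ ≤ ‖ρ.π (f s)‖ * ‖ρ.U s x‖ := (ρ.π (f s)).le_opNorm _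
            _ ≤ (C * ‖f s‖) * (M * ‖x‖) := by
              gcongr
              · exact (ρ.π.le_opNorm _).trans (by gcongr)
              · exact ((ρ.U s).le_opNorm _).trans (by gcongr; exact hM s hs)
            _ = _ := by ring
        · simp [eq_zero_of_notMem_tsupport f hs]
    _ = _ := by rw [integral_const_mul]; ring

/-- The integrated form `π ⋊ U (f) = ∫ π(f(s)) U_s ds`, an operator defined pointwise. -/
def integrated (μ : Measure G) [μ.IsHaarMeasure] (f : C_c(G, A)) : X →L[𝕜] X :=
  LinearMap.mkContinuousOfExistsBound
    { toFun := fun x => ∫ s, ρ.π (f s) (ρ.U s x) ∂μ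
      map_add' := fun x y => by
        simp only [map_add]
        exact integral_add (ρ.integrable μ f x) (ρ.integrable μ f y)
      map_smul' := fun c x => by
        simp only [map_smul]
        exact integral_smul c _ }
    (by
      obtain ⟨M, -, hM⟩ :=
        exists_bound_of_isCompact ρ.U ρ.continuous_U f.hasCompactSupport.isCompact
      exact ⟨_, ρ.norm_integral_le μ f (norm_nonneg ρ.π) le_rfl hM⟩)

theorem integrated_apply (μ : Measure G) [μ.IsHaarMeasure] (f : C_c(G, A)) (x : X) :
    ρ.integrated μ f x = ∫ s, ρ.π (f s) (ρ.U s x) ∂μ := rfl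

theorem integrated_add (μ : Measure G) [μ.IsHaarMeasure] (f g : C_c(G, A)) :
    ρ.integrated μ (f + g) = ρ.integrated μ f + ρ.integrated μ g := by
  ext x
  simp only [integrated_apply, add_apply]
  rw [← integral_add (ρ.integrable μ f x) (ρ.integrable μ g x)]
  simp

theorem integrated_smul (μ : Measure G) [μ.IsHaarMeasure] (c : 𝕜) (f : C_c(G, A)) :
    ρ.integrated μ (c • f) = c • ρ.integrated μ f := by
  ext x
  simp only [integrated_apply, smul_apply]
  rw [← integral_smul]
  simp

theorem integrated_conv (μ : Measure G) [μ.IsHaarMeasure] (f g : C_c(G, A)) :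
    ρ.integrated μ (twistedConv S μ f g) = ρ.integrated μ f * ρ.integrated μ g := by
  ext x
  let F : G → G → X := fun s r => ρ.π (convKernel S f g s r) (ρ.U s x)
  have hFc : Continuous F.uncurry :=
    ρ.continuous_comp continuous_fst (continuous_convKernel S f g) continuous_const
  have hFs : HasCompactSupport F.uncurry := by
    refine HasCompactSupport.intro
      ((f.hasCompactSupport.isCompact.mul g.hasCompactSupport.isCompact).prod
        f.hasCompactSupport.isCompact) ?_
    rintro ⟨r, t⟩ hrt
    by_cases ht : t ∈ tsupport f
    · have : t⁻¹ * r ∉ tsupport g := fun hh =>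
        hrt ⟨Set.mem_mul.2 ⟨t, ht, t⁻¹ * r, hh, by group⟩, ht⟩
      simp [F, Function.uncurry, convKernel, eq_zero_of_notMem_tsupport g this]
    · simp [F, Function.uncurry, convKernel, eq_zero_of_notMem_tsupport f ht]
  calc ρ.integrated μ (twistedConv S μ f g) x
      = ∫ s, ∫ r, F s r ∂μ ∂μ := by
        rw [integrated_apply]
        refine integral_congr_ae (.of_forall fun s => ?_)
        exact (ContinuousLinearMap.integral_comp_comm (ρ.π.flip (ρ.U s x))
          (integrable_convKernel S μ f g s)).symm
    _ = ∫ r, ∫ s, F s r ∂μ ∂μ := integral_integral_swap_of_hasCompactSupport hFc hFs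
    _ = ∫ r, ∫ s, F (r * s) r ∂μ ∂μ := by
        refine integral_congr_ae (.of_forall fun r => ?_)
        exact (integral_mul_left_eq_self (fun s => F s r) r).symm
    _ = ∫ r, ρ.π (f r) (ρ.U r (∫ s, ρ.π (g s) (ρ.U s x) ∂μ)) ∂μ := by
        refine integral_congr_ae (.of_forall fun r => ?_)
        have := ContinuousLinearMap.integral_comp_comm ((ρ.π (f r)).comp (ρ.U r))
          (ρ.integrable μ g x)
        simp only [ContinuousLinearMap.comp_apply] at this
        simp only
        rw [← this]
        refine integral_congr_ae (.of_forall fun s => ?_)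
        simp [F, convKernel, ρ.π_mul, ρ.covariant_apply]
    _ = _ := rfl

/-- `(π, U)` is non-degenerate if `π` is. -/
def IsNonDegenerate : Prop := NonDegenerate fun a => ρ.π a

/-- `(π, U)` is involutive: `X` is a Hilbert space (its norm comes from an inner product), `π` is a
`*`-representation and `U` is unitary. -/
def IsInvolutive [Star A] : Prop :=
  ∃ h : InnerProductSpace 𝕜 X, h.toNormedSpace = X.normedSpace ∧
    (∀ a (x y : X), inner 𝕜 (ρ.π a x) y = inner 𝕜 x (ρ.π (star a) y)) ∧
    ∀ s (x y : X), inner 𝕜 (ρ.U s x) (ρ.U s y) = inner 𝕜 x y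

/-- There is a constant `C_U` with `‖U_r‖ ≤ C_U` for all `r`. -/
def IsUniformlyBounded : Prop := ∃ C : ℝ, ∀ r, ‖ρ.U r‖ ≤ C

/-- A subspace is invariant for `(π, U)`. -/
def IsInvariant (Y : Submodule 𝕜 X) : Prop :=
  (∀ a, ∀ y ∈ Y, ρ.π a y ∈ Y) ∧ ∀ s, ∀ y ∈ Y, ρ.U s y ∈ Y

/-- `Φ` intertwines two covariant representations. -/
def Intertwines {X' : BanachSpace.{u, w} 𝕜} (ρ : CovRep S X) (ρ' : CovRep S X')
    (Φ : X →L[𝕜] X') : Prop :=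
  (∀ a, (ρ'.π a).comp Φ = Φ.comp (ρ.π a)) ∧ ∀ s, (ρ'.U s).comp Φ = Φ.comp (ρ.U s)

end CovRep

/-! ## Uniformly bounded classes and the crossed product -/

/-- A non-empty uniformly bounded class `𝓡` of continuous covariant representations. -/
structure UniformlyBoundedClass (S : DynSystem 𝕜 A G) where
  carrier : Set (Σ X : BanachSpace.{u, v} 𝕜, CovRep S X)
  nonempty : carrier.Nonempty
  bounded : ∃ (C : ℝ) (ν : G → ℝ), 0 ≤ C ∧ (∀ r, 0 ≤ ν r) ∧
    (∀ K : Set G, IsCompact K → BddAbove (ν '' K)) ∧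
    ∀ ρ ∈ carrier, ‖ρ.2.π‖ ≤ C ∧ ∀ r, ‖ρ.2.U r‖ ≤ ν r

namespace UniformlyBoundedClass

variable {S : DynSystem 𝕜 A G} (R : UniformlyBoundedClass.{u, v} S)

instance : Nonempty R.carrier := R.nonempty.to_subtype

/-- `ν^𝓡(r) = sup ‖U_r‖` over all `(π, U)` in `𝓡`. -/
def nu (r : G) : ℝ := ⨆ ρ : R.carrier, ‖ρ.1.2.U r‖

/-- `σ^𝓡(f) = sup ‖π ⋊ U (f)‖` over all `(π, U)` in `𝓡`. -/
def sigma (μ : Measure G) [μ.IsHaarMeasure] (f : C_c(G, A)) : ℝ :=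
  ⨆ ρ : R.carrier, ‖ρ.1.2.integrated μ f‖

theorem bddAbove_integrated (μ : Measure G) [μ.IsHaarMeasure] (f : C_c(G, A)) :
    BddAbove (Set.range fun ρ : R.carrier => ‖ρ.1.2.integrated μ f‖) := by
  obtain ⟨C, ν, hC, hν, hK, hb⟩ := R.bounded
  obtain ⟨M, hM⟩ := hK _ f.hasCompactSupport.isCompact
  refine ⟨C * max M 0 * ∫ s, ‖f s‖ ∂μ, ?_⟩
  rintro _ ⟨ρ, rfl⟩
  refine ContinuousLinearMap.opNorm_le_bound _ (by positivity) fun x => ?_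
  exact ρ.1.2.norm_integral_le μ f hC (hb _ ρ.2).1
    (fun s hs => ((hb _ ρ.2).2 s).trans ((hM ⟨s, hs, rfl⟩).trans (le_max_left _ _))) x

theorem norm_integrated_le_sigma (μ : Measure G) [μ.IsHaarMeasure] (f : C_c(G, A))
    (ρ : R.carrier) : ‖ρ.1.2.integrated μ f‖ ≤ R.sigma μ f :=
  le_ciSup (R.bddAbove_integrated μ f) ρ

theorem sigma_nonneg (μ : Measure G) [μ.IsHaarMeasure] (f : C_c(G, A)) : 0 ≤ R.sigma μ f :=
  Real.iSup_nonneg fun _ => norm_nonneg _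

theorem sigma_add_le (μ : Measure G) [μ.IsHaarMeasure] (f g : C_c(G, A)) :
    R.sigma μ (f + g) ≤ R.sigma μ f + R.sigma μ g :=
  ciSup_le fun ρ => by
    rw [CovRep.integrated_add]
    exact (norm_add_le _ _).trans
      (add_le_add (R.norm_integrated_le_sigma μ f ρ) (R.norm_integrated_le_sigma μ g ρ))

theorem sigma_smul (μ : Measure G) [μ.IsHaarMeasure] (c : 𝕜) (f : C_c(G, A)) :
    R.sigma μ (c • f) = ‖c‖ * R.sigma μ f := by
  simp only [sigma, CovRep.integrated_smul, norm_smul]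
  exact (Real.mul_iSup_of_nonneg (norm_nonneg _) _).symm

theorem sigma_neg (μ : Measure G) [μ.IsHaarMeasure] (f : C_c(G, A)) :
    R.sigma μ (-f) = R.sigma μ f := by
  have := R.sigma_smul μ (-1 : 𝕜) f
  rwa [neg_one_smul, norm_neg, norm_one, one_mul] at this

theorem sigma_conv_le (μ : Measure G) [μ.IsHaarMeasure] (f g : C_c(G, A)) :
    R.sigma μ (twistedConv S μ f g) ≤ R.sigma μ f * R.sigma μ g :=
  ciSup_le fun ρ => by
    rw [CovRep.integrated_conv]
    exact (norm_mul_le _ _).trans (mul_le_mul (R.norm_integrated_le_sigma μ f ρ)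
      (R.norm_integrated_le_sigma μ g ρ) (norm_nonneg _) (R.sigma_nonneg μ f))

/-- The algebra `C_c(G, A)`, with twisted convolution as product and `σ^𝓡` as seminorm. -/
def CcAlgebra (_μ : Measure G) (_R : UniformlyBoundedClass.{u, v} S) : Type _ := C_c(G, A)

variable (μ : Measure G) [μ.IsHaarMeasure]

instance : AddCommGroup (CcAlgebra μ R) := inferInstanceAs (AddCommGroup C_c(G, A))

instance : Module 𝕜 (CcAlgebra μ R) := inferInstanceAs (Module 𝕜 C_c(G, A))

/-- A function in `C_c(G, A)`, as an element of the algebra `CcAlgebra μ R`. -/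
def toCc (f : C_c(G, A)) : CcAlgebra μ R := f

/-- The seminorm `σ^𝓡`. -/
def sigmaSeminorm : AddGroupSeminorm (CcAlgebra μ R) where
  toFun f := R.sigma μ f
  map_zero' := by
    have := R.sigma_smul μ (0 : 𝕜) (0 : C_c(G, A))
    rw [zero_smul, norm_zero, zero_mul] at this
    exact this
  add_le' := R.sigma_add_le μ
  neg' f := R.sigma_neg μ f

instance : SeminormedAddCommGroup (CcAlgebra μ R) :=
  (sigmaSeminorm R μ).toSeminormedAddCommGroup

instance : NonUnitalSeminormedRing (CcAlgebra μ R) where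
  __ : SeminormedAddCommGroup (CcAlgebra μ R) := inferInstance
  mul f g := twistedConv S μ f g
  left_distrib := twistedConv_add_right S μ
  right_distrib := twistedConv_add_left S μ
  zero_mul := twistedConv_zero_left S μ
  mul_zero := twistedConv_zero_right S μ
  mul_assoc f g h := twistedConv_assoc S μ f g h
  norm_mul_le f g := R.sigma_conv_le μ f g

instance : NormedSpace 𝕜 (CcAlgebra μ R) where
  norm_smul_le c f := (R.sigma_smul μ c f).le

instance : IsScalarTower 𝕜 (CcAlgebra μ R) (CcAlgebra μ R) where
  smul_assoc := twistedConv_smul_left S μ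

instance : SMulCommClass 𝕜 (CcAlgebra μ R) (CcAlgebra μ R) where
  smul_comm c f g := (twistedConv_smul_right S μ c f g).symm

/-- The crossed product `(A ⋊_α G)^𝓡`: the (Hausdorff) completion of `C_c(G, A)` in the seminorm
`σ^𝓡`, i.e. the completion of `C_c(G, A) / ker σ^𝓡` in the induced norm. -/
def CrossedProduct : Type _ := UniformSpace.Completion (CcAlgebra μ R)

namespace CrossedProduct

instance : NormedAddCommGroup (R.CrossedProduct μ) :=
  inferInstanceAs (NormedAddCommGroup (UniformSpace.Completion (CcAlgebra μ R)))

instance : NormedSpace 𝕜 (R.CrossedProduct μ) :=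
  inferInstanceAs (NormedSpace 𝕜 (UniformSpace.Completion (CcAlgebra μ R)))

instance : CompleteSpace (R.CrossedProduct μ) :=
  inferInstanceAs (CompleteSpace (UniformSpace.Completion (CcAlgebra μ R)))

/-- The canonical map into the completion, as a continuous linear map. -/
def incl : CcAlgebra μ R →L[𝕜] R.CrossedProduct μ :=
  (UniformSpace.Completion.toComplL : CcAlgebra μ R →L[𝕜] UniformSpace.Completion (CcAlgebra μ R))

theorem denseRange_incl : DenseRange (incl R μ) :=
  UniformSpace.Completion.denseRange_coe (α := CcAlgebra μ R)

theorem isUniformInducing_incl : IsUniformInducing (incl R μ) :=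
  UniformSpace.Completion.isUniformInducing_coe (CcAlgebra μ R)

theorem norm_incl (f : CcAlgebra μ R) : ‖incl R μ f‖ = ‖f‖ :=
  UniformSpace.Completion.norm_coe f

/-- The product on the crossed product as a bounded bilinear map, extending that of `C_c(G, A)`. -/
def mulL : R.CrossedProduct μ →L[𝕜] R.CrossedProduct μ →L[𝕜] R.CrossedProduct μ :=
  ContinuousLinearMap.extend
    (ContinuousLinearMap.flip (ContinuousLinearMap.extend
      ((ContinuousLinearMap.compL 𝕜 (CcAlgebra μ R) (CcAlgebra μ R) (R.CrossedProduct μ)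
        (incl R μ)).comp (ContinuousLinearMap.mul 𝕜 (CcAlgebra μ R))).flip (incl R μ)))
    (incl R μ)

instance : Mul (R.CrossedProduct μ) := ⟨fun a b => mulL R μ a b⟩

theorem mul_def (a b : R.CrossedProduct μ) : a * b = mulL R μ a b := rfl

theorem incl_mul (f g : CcAlgebra μ R) : incl R μ (f * g) = incl R μ f * incl R μ g := by
  rw [mul_def, mulL, ContinuousLinearMap.extend_eq _ (denseRange_incl R μ)
    (isUniformInducing_incl R μ), ContinuousLinearMap.flip_apply, ContinuousLinearMap.extend_eq _
    (denseRange_incl R μ) (isUniformInducing_incl R μ)]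
  rfl

theorem continuous_mul : Continuous fun p : R.CrossedProduct μ × R.CrossedProduct μ => p.1 * p.2 :=
  ((mulL R μ).continuous.comp continuous_fst).clm_apply continuous_snd

@[elab_as_elim]
theorem induction {p : R.CrossedProduct μ → Prop} (a : R.CrossedProduct μ)
    (hp : IsClosed {a | p a}) (h : ∀ f, p (incl R μ f)) : p a :=
  (denseRange_incl R μ).induction_on a hp h

instance : NonUnitalNormedRing (R.CrossedProduct μ) where
  __ : NormedAddCommGroup (R.CrossedProduct μ) := inferInstance
  mul a b := mulL R μ a b
  left_distrib a b c := map_add _ _ _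
  right_distrib a b c := by
    change mulL R μ (a + b) c = mulL R μ a c + mulL R μ b c
    rw [map_add, add_apply]
  zero_mul a := by
    change mulL R μ 0 a = 0
    rw [map_zero, zero_apply]
  mul_zero a := map_zero _
  mul_assoc a b c := by
    have hm : ∀ {p q : R.CrossedProduct μ → R.CrossedProduct μ}, Continuous p → Continuous q →
        Continuous fun x => p x * q x := fun hp hq =>
      (continuous_mul R μ).comp (hp.prodMk hq)
    change a * b * c = a * (b * c)
    revert b c
    refine induction R μ a ?_ (fun f => ?_)
    · simp only [Set.ofPred_forall]
      refine isClosed_iInter fun b => isClosed_iInter fun c => ?_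
      exact isClosed_eq (hm (hm continuous_id continuous_const) continuous_const)
        (hm continuous_id continuous_const)
    intro b
    refine induction R μ b ?_ (fun g => ?_)
    · simp only [Set.ofPred_forall]
      refine isClosed_iInter fun c => ?_
      exact isClosed_eq (hm (hm continuous_const continuous_id) continuous_const)
        (hm continuous_const (hm continuous_id continuous_const))
    intro c
    refine induction R μ c ?_ (fun h => ?_)
    · exact isClosed_eq (hm continuous_const continuous_id)
        (hm continuous_const (hm continuous_const continuous_id))
    simp only [← incl_mul, mul_assoc]
  norm_mul_le a b := by
    change ‖a * b‖ ≤ ‖a‖ * ‖b‖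
    revert b
    refine induction R μ a ?_ (fun f => ?_)
    · simp only [Set.ofPred_forall]
      refine isClosed_iInter fun b => isClosed_le ?_ (by fun_prop)
      exact ((continuous_mul R μ).comp (continuous_id.prodMk continuous_const)).norm
    intro b
    refine induction R μ b ?_ (fun g => ?_)
    · refine isClosed_le ?_ (by fun_prop)
      exact ((continuous_mul R μ).comp (continuous_const.prodMk continuous_id)).norm
    rw [← incl_mul, norm_incl, norm_incl, norm_incl]
    exact norm_mul_le f g

instance : IsScalarTower 𝕜 (R.CrossedProduct μ) (R.CrossedProduct μ) where
  smul_assoc c a b := by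
    change mulL R μ (c • a) b = c • mulL R μ a b
    rw [map_smul, smul_apply]

instance : SMulCommClass 𝕜 (R.CrossedProduct μ) (R.CrossedProduct μ) where
  smul_comm c a b := (map_smul (mulL R μ a) c b).symm

end CrossedProduct

/-- The canonical map `q^𝓡 : C_c(G, A) → (A ⋊_α G)^𝓡`. -/
def q (f : C_c(G, A)) : R.CrossedProduct μ := CrossedProduct.incl R μ (toCc R μ f)

theorem q_conv (f g : C_c(G, A)) : R.q μ (twistedConv S μ f g) = R.q μ f * R.q μ g :=
  CrossedProduct.incl_mul R μ (toCc R μ f) (toCc R μ g)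

theorem norm_q (f : C_c(G, A)) : ‖R.q μ f‖ = R.sigma μ f :=
  CrossedProduct.norm_incl R μ (toCc R μ f)

theorem denseRange_q : DenseRange (R.q μ) := CrossedProduct.denseRange_incl R μ

end UniformlyBoundedClass

/-! ## Bounded representations of the crossed product, and integration -/

variable {S : DynSystem 𝕜 A G} (μ : Measure G) [μ.IsHaarMeasure]

/-- A bounded representation `T` of `(A ⋊_α G)^𝓡` in the Banach space `X`. -/
structure CrossedRep (R : UniformlyBoundedClass.{u, v} S) (X : BanachSpace.{u, w} 𝕜) where
  T : R.CrossedProduct μ →L[𝕜] (X →L[𝕜] X)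
  T_mul : ∀ a b, T (a * b) = T a * T b

namespace CrossedRep

variable {μ} {R : UniformlyBoundedClass.{u, v} S} {X : BanachSpace.{u, w} 𝕜}

/-- Non-degeneracy of `T`. -/
def IsNonDegenerate (τ : CrossedRep μ R X) : Prop := NonDegenerate fun c => τ.T c

/-- `T` is involutive, for a given involution on the crossed product: `X` is a Hilbert space and
`T` is a `*`-representation. -/
def IsInvolutive [Star (R.CrossedProduct μ)] (τ : CrossedRep μ R X) : Prop :=
  ∃ h : InnerProductSpace 𝕜 X, h.toNormedSpace = X.normedSpace ∧
    ∀ c (x y : X), inner 𝕜 (τ.T c x) y = inner 𝕜 x (τ.T (star c) y)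

/-- A subspace is invariant for `T`. -/
def IsInvariant (τ : CrossedRep μ R X) (Y : Submodule 𝕜 X) : Prop := ∀ c, ∀ y ∈ Y, τ.T c y ∈ Y

/-- `Φ` intertwines two representations of the crossed product. -/
def Intertwines {X' : BanachSpace.{u, w} 𝕜} (τ : CrossedRep μ R X) (τ' : CrossedRep μ R X')
    (Φ : X →L[𝕜] X') : Prop :=
  ∀ c, (τ'.T c).comp Φ = Φ.comp (τ.T c)

end CrossedRep

/-- `(π, U)` is `𝓡`-continuous: `π ⋊ U` is bounded with respect to `σ^𝓡`. -/
def CovRep.IsRContinuous (R : UniformlyBoundedClass.{u, v} S) {X : BanachSpace.{u, w} 𝕜}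
    (ρ : CovRep S X) : Prop :=
  ∃ C : ℝ, ∀ f : C_c(G, A), ‖ρ.integrated μ f‖ ≤ C * R.sigma μ f

section Integration

variable {μ} {R : UniformlyBoundedClass.{u, v} S} {X : BanachSpace.{u, w} 𝕜}

/-- The integrated form of an `𝓡`-continuous covariant representation, as a bounded map on
`C_c(G, A)` with the seminorm `σ^𝓡`. -/
def CovRep.integratedCc (ρ : CovRep S X) (h : ρ.IsRContinuous μ R) :
    UniformlyBoundedClass.CcAlgebra μ R →L[𝕜] (X →L[𝕜] X) :=
  LinearMap.mkContinuousOfExistsBound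
    { toFun := fun f => ρ.integrated μ f
      map_add' := ρ.integrated_add μ
      map_smul' := ρ.integrated_smul μ } h

/-- `(π ⋊ U)^𝓡`: the bounded representation of the crossed product determined by
`(π ⋊ U)^𝓡 (q^𝓡(f)) = π ⋊ U (f)`. -/
def CovRep.integration (ρ : CovRep S X) (h : ρ.IsRContinuous μ R) : CrossedRep μ R X where
  T := (ρ.integratedCc h).extend (UniformlyBoundedClass.CrossedProduct.incl R μ)
  T_mul a b := by
    set E := (ρ.integratedCc h).extend (UniformlyBoundedClass.CrossedProduct.incl R μ) with hE
    have hEq : ∀ f, E (UniformlyBoundedClass.CrossedProduct.incl R μ f) = ρ.integrated μ f :=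
      fun f => ContinuousLinearMap.extend_eq _
        (UniformlyBoundedClass.CrossedProduct.denseRange_incl R μ)
        (UniformlyBoundedClass.CrossedProduct.isUniformInducing_incl R μ) f
    revert b
    refine UniformlyBoundedClass.CrossedProduct.induction R μ a ?_ (fun f => ?_)
    · simp only [Set.ofPred_forall]
      exact isClosed_iInter fun b => isClosed_eq (by fun_prop) (by fun_prop)
    intro b
    refine UniformlyBoundedClass.CrossedProduct.induction R μ b ?_ (fun g => ?_)
    · exact isClosed_eq (by fun_prop) (by fun_prop)
    rw [← UniformlyBoundedClass.CrossedProduct.incl_mul, hEq, hEq, hEq]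
    exact ρ.integrated_conv μ f g

theorem CovRep.integration_q (ρ : CovRep S X) (h : ρ.IsRContinuous μ R) (f : C_c(G, A)) :
    (ρ.integration h).T (R.q μ f) = ρ.integrated μ f :=
  ContinuousLinearMap.extend_eq _ (UniformlyBoundedClass.CrossedProduct.denseRange_incl R μ)
    (UniformlyBoundedClass.CrossedProduct.isUniformInducing_incl R μ) _

end Integration

variable (R : UniformlyBoundedClass.{u, v} S)

/-- The class of all `𝓡`-continuous covariant representations (in Banach spaces in `Type w`). -/
abbrev RContinuousCovRep : Type _ :=
  Σ X : BanachSpace.{u, w} 𝕜, {ρ : CovRep S X // ρ.IsRContinuous μ R}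

/-- The class of all bounded representations of the crossed product (in Banach spaces in
`Type w`). -/
abbrev BoundedCrossedRep : Type _ := Σ X : BanachSpace.{u, w} 𝕜, CrossedRep μ R X

/-- The assignment `(π, U) ↦ (π ⋊ U)^𝓡`. -/
def integrationMap (p : RContinuousCovRep.{u, v, w} μ R) : BoundedCrossedRep.{u, v, w} μ R :=
  ⟨p.1, p.2.1.integration p.2.2⟩

end Main

end

end CrossedProd

namespace CrossedProd

noncomputable section

set_option linter.unusedSectionVars false

open scoped Pointwise

universe u v w

/-! ## Strong limits of bounded families of operators -/

section StrongLimits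

variable {𝕜 : Type*} [RCLike 𝕜] {X Y : Type*} [NormedAddCommGroup X] [NormedSpace 𝕜 X]
  [NormedAddCommGroup Y] [NormedSpace 𝕜 Y] {ι : Type*} {l : Filter ι} {F : ι → X →L[𝕜] Y} {K : ℝ}

/-! The two constants make `σ^𝓡` equivalent to the `L¹`-norm on `C_c(G, A)`. If `‖π‖ ≤ C` and `‖U_r‖
≤ D` throughout `𝓡`, then `σ^𝓡(f) ≤ C D ‖f‖₁`, and the reverse estimate is assumed. Since `C_c(G,
A)` is dense in `L¹(G, A)`, the crossed product is `L¹(G, A)` up to an equivalent norm, and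
uniformly bounded covariant representations are `𝓡`-continuous.

Surjectivity of the integration map (`CrossedRep.exists_covRep`) is a left centralizer argument.
Left multiplication by `a` and translation by `r` are `σ^𝓡`-bounded on `C_c(G, A)` and commute with
convolution on the right. The functions `φ ⊗ u`, with `φ` close to the point mass at `1` and `u` in
the approximate identity of `A`, form a bounded approximate left identity, so each centralizer `L`
induces an operator `V` with `V T(f) = T(L f)` (`exists_operator_of_left_centralizer`). This yields
`π(a)` and `U_r`. As `f * g` is the `L¹`-valued integral of `s ↦ f(s) α_s(g(s⁻¹ ·))`
(`integral_toLOne_convSlice`), one gets `π ⋊ U (f) T(g) = T(f * g) = T(f) T(g)`, whence `π ⋊ U = T`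
on `C_c(G, A)` by non-degeneracy.

Injectivity and the statements on subspaces and intertwiners use that `π(a) U_s` is the strong limit
of `π ⋊ U` at translated bumps `φ(s⁻¹ ·) ⊗ a` (`CovRep.tendsto_integrated_bump`), while `U_s` is the
strong limit of `U_s π(u)`.

The product of two elements of `L¹` is found by expanding both in absolutely convergent series from
`C_c(G, A)` and summing pointwise almost everywhere (`lOneEquiv_symm_mul`). In the involutive case
`π ⋊ U (f*)` is the adjoint of `π ⋊ U (f)`, so the involution and the `C*`-identity come from
operators on Hilbert space by taking the supremum over `𝓡`; the converse for a single representation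
again takes limits along bumps. -/

theorem exists_tendsto_of_dense_span [CompleteSpace Y] [l.NeBot] (hK : ∀ᶠ i in l, ‖F i‖ ≤ K)
    {s : Set X} (hs : Dense (Submodule.span 𝕜 s : Set X))
    (h : ∀ x ∈ s, ∃ y, Tendsto (fun i => F i x) l (𝓝 y)) :
    ∃ V : X →L[𝕜] Y, (∀ x, Tendsto (fun i => F i x) l (𝓝 (V x))) ∧ ‖V‖ ≤ K := by
  have hK0 : 0 ≤ K := by
    obtain ⟨i, hi⟩ := hK.exists
    exact (norm_nonneg _).trans hi
  have hspan : ∀ x ∈ Submodule.span 𝕜 s, ∃ y, Tendsto (fun i => F i x) l (𝓝 y) := fun x hx => by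
    induction hx using Submodule.span_induction with
    | mem x hx => exact h x hx
    | zero => exact ⟨0, by simp⟩
    | add x y _ _ hx hy =>
      obtain ⟨x', hx'⟩ := hx
      obtain ⟨y', hy'⟩ := hy
      exact ⟨x' + y', by simpa using hx'.add hy'⟩
    | smul c x _ hx =>
      obtain ⟨x', hx'⟩ := hx
      exact ⟨c • x', by simpa using hx'.const_smul c⟩
  have hall : ∀ x, ∃ y, Tendsto (fun i => F i x) l (𝓝 y) := fun x => by
    rw [← cauchy_map_iff_exists_tendsto, Metric.cauchy_iff]
    refine ⟨inferInstance, fun ε hε => ?_⟩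
    -- The radius makes `F i x` and `F i y` differ by at most `ε / 4`, uniformly in `i`; `K + 1`
    -- stays positive when `K = 0`.
    obtain ⟨y, hy, hys⟩ := Metric.dense_iff.1 hs x (ε / (4 * (K + 1))) (by positivity)
    obtain ⟨z, hz⟩ := hspan y hys
    refine ⟨Metric.ball z (ε / 2), ?_, fun a ha b hb => ?_⟩
    · refine mem_map.2 ?_
      filter_upwards [hK, hz.eventually (Metric.ball_mem_nhds z (show 0 < ε / 4 by positivity))]
        with i hi hiz
      have h1 : dist (F i x) (F i y) ≤ ε / 4 := by
        rw [dist_eq_norm, ← map_sub]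
        calc ‖F i (x - y)‖ ≤ K * ‖x - y‖ := ((F i).le_opNorm _).trans (by gcongr)
          _ ≤ (K + 1) * (ε / (4 * (K + 1))) := by
            rw [← dist_eq_norm, dist_comm]
            have := (Metric.mem_ball.1 hy).le
            gcongr
            linarith
          _ = ε / 4 := by field_simp
      have h2 : dist (F i y) z < ε / 4 := hiz
      calc dist (F i x) z ≤ dist (F i x) (F i y) + dist (F i y) z := dist_triangle _ _ _
        _ < ε / 2 := by linarith
    · have := dist_triangle_right a b z
      have h1 := Metric.mem_ball.1 ha
      have h2 := Metric.mem_ball.1 hb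
      linarith
  choose V hV using hall
  refine ⟨LinearMap.mkContinuous
    { toFun := V
      map_add' := fun x y => tendsto_nhds_unique (hV (x + y)) (by simpa using (hV x).add (hV y))
      map_smul' := fun c x =>
        tendsto_nhds_unique (hV (c • x)) (by simpa using (hV x).const_smul c) } K fun x => ?_,
    hV, LinearMap.mkContinuous_norm_le _ hK0 _⟩
  refine le_of_tendsto (hV x).norm ?_
  filter_upwards [hK] with i hi
  exact ((F i).le_opNorm _).trans (by gcongr)

/-- The same density argument with the limit operator known in advance. It serves for strong
continuity of `U` and for approximate identities acting on `X`. -/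
theorem tendsto_of_dense_span (hK : ∀ᶠ i in l, ‖F i‖ ≤ K) (V : X →L[𝕜] Y)
    {s : Set X} (hs : Dense (Submodule.span 𝕜 s : Set X))
    (h : ∀ x ∈ s, Tendsto (fun i => F i x) l (𝓝 (V x))) (x : X) :
    Tendsto (fun i => F i x) l (𝓝 (V x)) := by
  rcases l.eq_or_neBot with rfl | _
  · exact tendsto_bot
  have h' : ∀ x ∈ Submodule.span 𝕜 s, Tendsto (fun i => F i x) l (𝓝 (V x)) := fun x hx => by
    induction hx using Submodule.span_induction with
    | mem x hx => exact h x hx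
    | zero => simp
    | add x y _ _ hx hy => simpa using hx.add hy
    | smul c x _ hx => simpa using hx.const_smul c
  have hK0 : 0 ≤ K := by
    obtain ⟨i, hi⟩ := hK.exists
    exact (norm_nonneg _).trans hi
  rw [Metric.tendsto_nhds]
  intro ε hε
  have hL : 0 < K + ‖V‖ + 1 := by positivity
  obtain ⟨y, hy, hys⟩ := Metric.dense_iff.1 hs x (ε / 2 / (K + ‖V‖ + 1)) (by positivity)
  have hxy : ‖x - y‖ ≤ ε / 2 / (K + ‖V‖ + 1) := by
    rw [← dist_eq_norm, dist_comm]
    exact (Metric.mem_ball.1 hy).le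
  filter_upwards [hK, (h' y hys).eventually (Metric.ball_mem_nhds _ (half_pos hε))] with i hi hiy
  have hiy' : ‖F i y - V y‖ < ε / 2 := by rw [← dist_eq_norm]; exact hiy
  have h2 : F i x - V x = F i (x - y) + (F i y - V y) - V (x - y) := by
    rw [map_sub, map_sub]; abel
  have h3 : ‖F i (x - y)‖ ≤ K * ‖x - y‖ := ((F i).le_opNorm _).trans (by gcongr)
  have h4 : ‖V (x - y)‖ ≤ ‖V‖ * ‖x - y‖ := V.le_opNorm _
  have h5 : (K + ‖V‖) * ‖x - y‖ ≤ ε / 2 :=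
    calc (K + ‖V‖) * ‖x - y‖ ≤ (K + ‖V‖ + 1) * (ε / 2 / (K + ‖V‖ + 1)) :=
          mul_le_mul (by linarith) hxy (norm_nonneg _) hL.le
      _ = ε / 2 := by field_simp
  have h6 := norm_sub_le (F i (x - y) + (F i y - V y)) (V (x - y))
  have h7 := norm_add_le (F i (x - y)) (F i y - V y)
  rw [dist_eq_norm, h2]
  linarith

end StrongLimits

/-! ## Approximate identities on the group -/

section Group

variable {G : Type*} [Group G] [TopologicalSpace G] [IsTopologicalGroup G] [LocallyCompactSpace G]
  [T2Space G] [MeasurableSpace G] [BorelSpace G]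

/-- The functions in `C_c(G, ℝ)` that are densities of probability measures supported in `V`. -/
def probDensities (μ : Measure G) (V : Set G) : Set C_c(G, ℝ) :=
  {φ | (∀ s, 0 ≤ φ s) ∧ ∫ s, φ s ∂μ = 1 ∧ tsupport φ ⊆ V}

/-- The filter of probability densities in `C_c(G, ℝ)` whose support shrinks to the identity. -/
def deltaFilter (μ : Measure G) : Filter C_c(G, ℝ) := (𝓝 (1 : G)).lift' (probDensities μ)

theorem probDensities_mono (μ : Measure G) : Monotone (probDensities μ) :=
  fun _ _ h _ hφ => ⟨hφ.1, hφ.2.1, hφ.2.2.trans h⟩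

theorem eventually_deltaFilter (μ : Measure G) {V : Set G} (hV : V ∈ 𝓝 (1 : G)) :
    ∀ᶠ φ in deltaFilter μ, φ ∈ probDensities μ V :=
  mem_lift' hV

theorem exists_mem_probDensities (μ : Measure G) [μ.IsHaarMeasure] {V : Set G}
    (hV : V ∈ 𝓝 (1 : G)) : (probDensities μ V).Nonempty := by
  -- A closed set inside `V` is needed because `probDensities` constrains the closed support. The
  -- density is then a normalized Urysohn function vanishing off the interior of `K`.
  obtain ⟨K, hK, hKc, hKV⟩ : ∃ K ∈ 𝓝 (1 : G), IsCompact K ∧ K ⊆ V := by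
    obtain ⟨K, hK, hKV, hKc⟩ := local_compact_nhds hV
    exact ⟨K, hK, hKc, hKV⟩
  obtain ⟨f, hf1, hf0, hfc, hf⟩ := exists_continuous_one_zero_of_isCompact
    (isCompact_singleton (x := (1 : G))) isOpen_interior.isClosed_compl
    (Set.disjoint_compl_right_iff_subset.2
      (Set.singleton_subset_iff.2 (mem_interior_iff_mem_nhds.2 hK)))
  have h1 : f 1 = 1 := hf1 rfl
  have hpos : 0 < ∫ s, f s ∂μ :=
    f.continuous.integral_pos_of_hasCompactSupport_nonneg_nonzero hfc (fun s => (hf s).1)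
      (by rw [h1]; exact one_ne_zero)
  have hts : tsupport f ⊆ K := by
    refine closure_minimal (fun s hs => ?_) hKc.isClosed
    by_contra h
    exact hs (hf0 fun hi => h (interior_subset hi))
  refine ⟨⟨⟨fun s => (∫ s, f s ∂μ)⁻¹ * f s, by fun_prop⟩, hfc.mul_left⟩, fun s => ?_, ?_, ?_⟩
  · exact mul_nonneg (inv_nonneg.2 hpos.le) (hf s).1
  · change ∫ s, (∫ s, f s ∂μ)⁻¹ * f s ∂μ = 1
    rw [integral_const_mul, inv_mul_cancel₀ hpos.ne']
  · refine (closure_mono fun s hs => ?_).trans (hts.trans hKV)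
    exact right_ne_zero_of_mul hs

instance neBot_deltaFilter (μ : Measure G) [μ.IsHaarMeasure] : (deltaFilter μ).NeBot :=
  (lift'_neBot_iff (probDensities_mono μ)).2 fun _ hV => exists_mem_probDensities μ hV

theorem norm_integral_smul_sub_le (μ : Measure G) [μ.IsHaarMeasure] {E : Type*}
    [NormedAddCommGroup E] [NormedSpace ℝ E] [CompleteSpace E] {φ : C_c(G, ℝ)} {V : Set G}
    (hφ : φ ∈ probDensities μ V) {h : G → E} (hc : Continuous h) {y : E} {ε : ℝ}
    (hε : ∀ s ∈ V, ‖h s - y‖ ≤ ε) : ‖∫ s, φ s • h s ∂μ - y‖ ≤ ε := by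
  have hi : Integrable φ μ := φ.continuous.integrable_of_hasCompactSupport φ.hasCompactSupport
  have hi2 : Integrable (fun s => φ s • h s) μ :=
    (φ.continuous.smul hc).integrable_of_hasCompactSupport φ.hasCompactSupport.smul_right
  have hy : y = ∫ s, φ s • y ∂μ := by rw [integral_smul_const, hφ.2.1, one_smul]
  nth_rw 1 [hy]
  rw [← integral_sub hi2 (hi.smul_const y)]
  calc ‖∫ s, (φ s • h s - φ s • y) ∂μ‖ ≤ ∫ s, φ s * ε ∂μ := by
        refine norm_integral_le_of_norm_le (hi.mul_const _) (.of_forall fun s => ?_)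
        rw [← smul_sub, norm_smul, Real.norm_of_nonneg (hφ.1 s)]
        by_cases hs : s ∈ tsupport φ
        · exact mul_le_mul_of_nonneg_left (hε s (hφ.2.2 hs)) (hφ.1 s)
        · simp [image_eq_zero_of_notMem_tsupport hs]
    _ = ε := by rw [integral_mul_const, hφ.2.1, one_mul]

theorem tendsto_integral_deltaFilter (μ : Measure G) [μ.IsHaarMeasure] {E : Type*}
    [NormedAddCommGroup E] [NormedSpace ℝ E] [CompleteSpace E] {h : G → E} (hc : Continuous h) :
    Tendsto (fun φ : C_c(G, ℝ) => ∫ s, φ s • h s ∂μ) (deltaFilter μ) (𝓝 (h 1)) := by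
  rw [Metric.tendsto_nhds]
  intro ε hε
  have hV : {s | ‖h s - h 1‖ < ε / 2} ∈ 𝓝 (1 : G) := by
    have : Tendsto (fun s => ‖h s - h 1‖) (𝓝 1) (𝓝 0) := by
      have h2 : Continuous fun s => ‖h s - h 1‖ := by fun_prop
      simpa using h2.tendsto 1
    exact this.eventually (gt_mem_nhds (half_pos hε))
  filter_upwards [eventually_deltaFilter μ hV] with φ hφ
  rw [dist_eq_norm]
  exact (norm_integral_smul_sub_le μ hφ hc fun s hs => le_of_lt hs).trans_lt (half_lt_self hε)

end Group

section Functions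

variable {𝕜 : Type u} [RCLike 𝕜]
  {A : Type*} [NonUnitalNormedRing A] [NormedSpace 𝕜 A] [NormedSpace ℝ A] [IsScalarTower ℝ 𝕜 A]
  [IsScalarTower 𝕜 A A] [SMulCommClass 𝕜 A A] [CompleteSpace A]
  {G : Type*} [Group G] [TopologicalSpace G] [IsTopologicalGroup G] [LocallyCompactSpace G]
  [T2Space G] [MeasurableSpace G] [BorelSpace G]

/-! ## Translations, left multiplications and elementary functions -/

theorem integrable_norm_cc (μ : Measure G) [μ.IsHaarMeasure] (f : C_c(G, A)) :
    Integrable (fun s => ‖f s‖) μ :=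
  (f.continuous.integrable_of_hasCompactSupport f.hasCompactSupport).norm

/-- The function `t ↦ φ(s⁻¹t) a`. -/
def bump (φ : C_c(G, ℝ)) (s : G) (a : A) : C_c(G, A) where
  toFun t := φ (s⁻¹ * t) • a
  continuous_toFun := by fun_prop
  hasCompactSupport' := HasCompactSupport.intro (φ.hasCompactSupport.isCompact.smul s)
    fun t ht => by
      have : s⁻¹ * t ∉ tsupport φ := fun h => ht (Set.mem_smul_set.2 ⟨_, h, by simp⟩)
      simp [image_eq_zero_of_notMem_tsupport this]

theorem bump_apply (φ : C_c(G, ℝ)) (s : G) (a : A) (t : G) : bump φ s a t = φ (s⁻¹ * t) • a := rfl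

/-- Left multiplication of functions by `a`. -/
def leftMul (a : A) (f : C_c(G, A)) : C_c(G, A) where
  toFun t := a * f t
  continuous_toFun := by fun_prop
  hasCompactSupport' := f.hasCompactSupport.mul_left

theorem leftMul_apply (a : A) (f : C_c(G, A)) (t : G) : leftMul a f t = a * f t := rfl

/-- The translation `(s · f)(t) = α_s(f(s⁻¹t))`. -/
def translate (S : DynSystem 𝕜 A G) (s : G) (f : C_c(G, A)) : C_c(G, A) where
  toFun t := S.act s (f (s⁻¹ * t))
  continuous_toFun := by fun_prop
  hasCompactSupport' := HasCompactSupport.intro (f.hasCompactSupport.isCompact.smul s)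
    fun t ht => by
      have : s⁻¹ * t ∉ tsupport f := fun h => ht (Set.mem_smul_set.2 ⟨_, h, by simp⟩)
      simp [eq_zero_of_notMem_tsupport f this]

theorem translate_apply (S : DynSystem 𝕜 A G) (s : G) (f : C_c(G, A)) (t : G) :
    translate S s f t = S.act s (f (s⁻¹ * t)) := rfl

variable (S : DynSystem 𝕜 A G)

theorem act_act (s t : G) (a : A) : S.act s (S.act t a) = S.act (s * t) a := by
  rw [map_mul]; rfl

theorem translate_one (f : C_c(G, A)) : translate S 1 f = f := by
  ext t; simp [translate_apply]

theorem translate_translate (s t : G) (f : C_c(G, A)) :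
    translate S s (translate S t f) = translate S (s * t) f := by
  ext r; simp only [translate_apply, act_act, mul_inv_rev, mul_assoc]

theorem leftMul_leftMul (a b : A) (f : C_c(G, A)) :
    leftMul a (leftMul b f) = leftMul (a * b) f := by
  ext r; simp [leftMul_apply, mul_assoc]

/-- Covariance at the level of functions; it becomes the covariance of the pair `(π, U)` constructed
from a representation of the crossed product. -/
theorem leftMul_act (s : G) (a : A) (f : C_c(G, A)) :
    leftMul (S.act s a) f = translate S s (leftMul a (translate S s⁻¹ f)) := by
  ext r; simp [leftMul_apply, translate_apply, act_act, S.act_mul]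

/-- Together with `translate_conv` this says that `A` and `G` act on the convolution algebra by left
centralizers, which is what lets them act on the space of a non-degenerate representation. -/
theorem leftMul_conv (μ : Measure G) [μ.IsHaarMeasure] (a : A) (f g : C_c(G, A)) :
    leftMul a (twistedConv S μ f g) = twistedConv S μ (leftMul a f) g := by
  ext s
  rw [leftMul_apply, twistedConv_apply, twistedConv_apply]
  have := ContinuousLinearMap.integral_comp_comm (ContinuousLinearMap.mul 𝕜 A a)
    (integrable_convKernel S μ f g s)
  simp only [ContinuousLinearMap.mul_apply'] at this
  rw [← this]
  simp [convKernel, leftMul_apply, mul_assoc]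

theorem translate_conv (μ : Measure G) [μ.IsHaarMeasure] (r : G) (f g : C_c(G, A)) :
    translate S r (twistedConv S μ f g) = twistedConv S μ (translate S r f) g := by
  ext s
  rw [translate_apply, twistedConv_apply, twistedConv_apply,
    ← ContinuousLinearMap.integral_comp_comm (S.act r) (integrable_convKernel S μ f g (r⁻¹ * s)),
    ← integral_mul_left_eq_self (convKernel S (translate S r f) g s) r]
  simp only [convKernel, translate_apply, S.act_mul, act_act, mul_inv_rev, mul_assoc,
    inv_mul_cancel_left]

/-! ## Estimates in the norm of `L¹` -/

theorem integral_norm_le_of_forall (μ : Measure G) [μ.IsHaarMeasure] {f : C_c(G, A)} {Q : Set G}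
    (hQ : IsCompact Q) {ε : ℝ} (h0 : ∀ s ∉ Q, f s = 0) (hε : ∀ s ∈ Q, ‖f s‖ ≤ ε) :
    ∫ s, ‖f s‖ ∂μ ≤ ε * μ.real Q := by
  rw [← setIntegral_eq_integral_of_forall_compl_eq_zero (s := Q) fun s hs => by simp [h0 s hs]]
  calc ∫ s in Q, ‖f s‖ ∂μ ≤ ∫ s in Q, ε ∂μ :=
        setIntegral_mono_on (integrable_norm_cc μ f).integrableOn
          (integrableOn_const hQ.measure_ne_top) hQ.measurableSet hε
    _ = ε * μ.real Q := by simp [mul_comm]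

/-- Uniform convergence with supports in a common compact set implies convergence in `L¹`. All the
`L¹`-limits of functions in `C_c(G, A)` below are reduced to this. -/
theorem tendsto_integral_norm_sub (μ : Measure G) [μ.IsHaarMeasure] {ι : Type*} {l : Filter ι}
    {F : ι → C_c(G, A)} {f : C_c(G, A)} {Q : Set G} (hQ : IsCompact Q)
    (h0 : ∀ᶠ i in l, ∀ s ∉ Q, (F i - f) s = 0)
    (hε : ∀ ε > 0, ∀ᶠ i in l, ∀ s ∈ Q, ‖(F i - f) s‖ ≤ ε) :
    Tendsto (fun i => ∫ s, ‖(F i - f) s‖ ∂μ) l (𝓝 0) := by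
  rw [Metric.tendsto_nhds]
  intro ε hε0
  have hm : 0 < μ.real Q + 1 := by positivity
  filter_upwards [h0, hε (ε / (μ.real Q + 1)) (by positivity)] with i hi0 hi
  rw [dist_zero_right, Real.norm_of_nonneg (by positivity)]
  calc ∫ s, ‖(F i - f) s‖ ∂μ ≤ ε / (μ.real Q + 1) * μ.real Q :=
        integral_norm_le_of_forall μ hQ hi0 hi
    _ < ε / (μ.real Q + 1) * (μ.real Q + 1) := by gcongr; linarith
    _ = ε := by field_simp

/-- A jointly continuous family of functions with supports in a common compact set is continuous
in the uniform norm. -/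
theorem eventually_forall_norm_sub_le {Z : Type*} [TopologicalSpace Z] {F : Z → C_c(G, A)} {z : Z}
    (hF : Continuous fun p : Z × G => F p.1 p.2) {Q : Set G} (hQ : IsCompact Q)
    (h0 : ∀ᶠ z' in 𝓝 z, ∀ s ∉ Q, F z' s = 0) {ε : ℝ} (hε : 0 < ε) :
    ∀ᶠ z' in 𝓝 z, ∀ s, ‖F z' s - F z s‖ ≤ ε := by
  have h : ∀ s ∈ Q, ∀ᶠ p : Z × G in 𝓝 z ×ˢ 𝓝 s, ‖F p.1 p.2 - F z p.2‖ < ε := fun s _ => by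
    rw [← nhds_prod_eq]
    have hc : Continuous fun p : Z × G => ‖F p.1 p.2 - F z p.2‖ := by
      have : Continuous fun p : Z × G => F z p.2 := by fun_prop
      fun_prop
    refine hc.tendsto (z, s) |>.eventually (gt_mem_nhds ?_)
    simpa using hε
  have := hQ.eventually_forall_of_forall_eventually (P := fun z' s => ‖F z' s - F z s‖ < ε)
    (fun s hs => by rw [nhds_prod_eq]; exact h s hs)
  filter_upwards [this, h0] with z' hz' hz0 s
  by_cases hs : s ∈ Q
  · exact (hz' s hs).le
  · simp [hz0 s hs, h0.self_of_nhds s hs, hε.le]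

theorem tendsto_integral_norm_sub_of_continuous (μ : Measure G) [μ.IsHaarMeasure] {Z : Type*}
    [TopologicalSpace Z] {F : Z → C_c(G, A)} {z : Z}
    (hF : Continuous fun p : Z × G => F p.1 p.2) {Q : Set G} (hQ : IsCompact Q)
    (h0 : ∀ᶠ z' in 𝓝 z, ∀ s ∉ Q, F z' s = 0) :
    Tendsto (fun z' => ∫ s, ‖(F z' - F z) s‖ ∂μ) (𝓝 z) (𝓝 0) := by
  refine tendsto_integral_norm_sub μ hQ ?_ fun ε hε => ?_
  · filter_upwards [h0] with z' hz' s hs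
    simp [hz' s hs, h0.self_of_nhds s hs]
  · filter_upwards [eventually_forall_norm_sub_le hF hQ h0 hε] with z' hz' s _
    exact hz' s

theorem continuous_translate (f : C_c(G, A)) :
    Continuous fun p : G × G => translate S p.1 f p.2 :=
  S.continuous_comp (Z := G × G) (p := fun p => p.1) (q := fun p => f (p.1⁻¹ * p.2))
    (by fun_prop) (by fun_prop)

theorem translate_eq_zero (f : C_c(G, A)) {K : Set G} {r s : G} (hr : r ∈ K)
    (hs : s ∉ K * tsupport f) : translate S r f s = 0 := by
  have : r⁻¹ * s ∉ tsupport f := fun h => hs (Set.mem_mul.2 ⟨r, hr, _, h, by group⟩)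
  simp [translate_apply, eq_zero_of_notMem_tsupport f this]

theorem tendsto_translate (μ : Measure G) [μ.IsHaarMeasure] (f : C_c(G, A)) (r : G) :
    Tendsto (fun r' => ∫ s, ‖(translate S r' f - translate S r f) s‖ ∂μ) (𝓝 r) (𝓝 0) := by
  obtain ⟨K, hK, hr⟩ := exists_compact_mem_nhds r
  refine tendsto_integral_norm_sub_of_continuous μ (F := fun r' => translate S r' f)
    (continuous_translate S f) (hK.mul f.hasCompactSupport.isCompact) ?_
  filter_upwards [hr] with r' hr' s hs
  exact translate_eq_zero S f hr' hs

/-- A bounded family that converges pointwise to the identity converges uniformly on compact sets,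
here on the image of the support of `f`. Compactness enters through induction over local estimates.
-/
theorem eventually_forall_norm_leftMul_sub_le {l : Filter A} {M : ℝ} (hM : ∀ᶠ x in l, ‖x‖ ≤ M)
    (hl : ∀ a : A, Tendsto (fun x => x * a) l (𝓝 a)) (f : C_c(G, A)) {ε : ℝ} (hε : 0 < ε) :
    ∀ᶠ x in l, ∀ s, ‖x * f s - f s‖ ≤ ε := by
  have key : ∀ᶠ x in l, ∀ s ∈ tsupport f, ‖x * f s - f s‖ ≤ ε := by
    refine f.hasCompactSupport.isCompact.induction_on
      (p := fun Q => ∀ᶠ x in l, ∀ s ∈ Q, ‖x * f s - f s‖ ≤ ε) (by simp)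
      (fun P Q hPQ h => h.mono fun x hx s hs => hx s (hPQ hs))
      (fun P Q hP hQ => by
        filter_upwards [hP, hQ] with x hx hx' s hs using hs.elim (hx s) (hx' s)) fun s _ => ?_
    have hM' : 0 < |M| + 1 := by positivity
    -- The difference `f s' - f s` is used twice, once multiplied by `x` and once alone, at total
    -- cost `(|M| + 1) * (ε / 2 / (|M| + 1)) = ε / 2`.
    refine ⟨{s' | ‖f s' - f s‖ < ε / 2 / (|M| + 1)}, mem_nhdsWithin_of_mem_nhds ?_, ?_⟩
    · have hc : Continuous fun s' => ‖f s' - f s‖ := by fun_prop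
      refine (hc.tendsto s).eventually (gt_mem_nhds ?_)
      simp only [sub_self, norm_zero]
      positivity
    · have h1 : ∀ᶠ x in l, ‖x * f s - f s‖ < ε / 2 := by
        have := (hl (f s)).eventually (Metric.ball_mem_nhds _ (half_pos hε))
        simpa [dist_eq_norm] using this
      filter_upwards [h1, hM] with x hx hxM s' hs'
      have h2 : x * f s' - f s' = x * (f s' - f s) - (f s' - f s) + (x * f s - f s) := by
        rw [mul_sub]; abel
      have hs2 : ‖f s' - f s‖ ≤ ε / 2 / (|M| + 1) := le_of_lt hs'
      calc ‖x * f s' - f s'‖ ≤ ‖x‖ * ‖f s' - f s‖ + ‖f s' - f s‖ + ‖x * f s - f s‖ := by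
            rw [h2]
            exact (norm_add_le _ _).trans (add_le_add_left ((norm_sub_le _ _).trans
              (add_le_add_left (norm_mul_le _ _) _)) _)
        _ ≤ |M| * (ε / 2 / (|M| + 1)) + ε / 2 / (|M| + 1) + ε / 2 := by
            gcongr
            exact hxM.trans (le_abs_self M)
        _ = ε := by field_simp; ring
  filter_upwards [key] with x hx s
  by_cases hs : s ∈ tsupport f
  · exact hx s hs
  · simp [eq_zero_of_notMem_tsupport f hs, hε.le]

theorem tendsto_leftMul (μ : Measure G) [μ.IsHaarMeasure] {l : Filter A} {M : ℝ}
    (hM : ∀ᶠ x in l, ‖x‖ ≤ M) (hl : ∀ a : A, Tendsto (fun x => x * a) l (𝓝 a)) (f : C_c(G, A)) :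
    Tendsto (fun x => ∫ s, ‖(leftMul x f - f) s‖ ∂μ) l (𝓝 0) := by
  refine tendsto_integral_norm_sub μ f.hasCompactSupport.isCompact (.of_forall fun x s hs => ?_)
    fun ε hε => ?_
  · simp [leftMul_apply, eq_zero_of_notMem_tsupport f hs]
  · filter_upwards [eventually_forall_norm_leftMul_sub_le hM hl f hε] with x hx s _
    exact hx s

/-- The functions `φ ⊗ u`, with `φ` approximating the point mass at the identity and `u` running
through a bounded approximate left identity of `A`, form an approximate left identity. -/
theorem tendsto_bump_conv (μ : Measure G) [μ.IsHaarMeasure] {l : Filter A} {M : ℝ}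
    (hM : ∀ᶠ x in l, ‖x‖ ≤ M) (hl : ∀ a : A, Tendsto (fun x => x * a) l (𝓝 a)) (f : C_c(G, A)) :
    Tendsto (fun p : C_c(G, ℝ) × A => ∫ s, ‖(twistedConv S μ (bump p.1 1 p.2) f - f) s‖ ∂μ)
      (deltaFilter μ ×ˢ l) (𝓝 0) := by
  obtain ⟨K, hK, h1⟩ := exists_compact_mem_nhds (1 : G)
  have hvan : ∀ r ∈ K, ∀ s ∉ K * tsupport f, translate S r f s = 0 := fun r hr s hs =>
    translate_eq_zero S f hr hs
  refine tendsto_integral_norm_sub μ (hK.mul f.hasCompactSupport.isCompact) ?_ fun ε hε => ?_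
  · filter_upwards [(eventually_deltaFilter μ h1).prod_inl l] with p hp s hs
    have h2 : f s = 0 := by
      simpa [translate_one] using hvan 1 (mem_of_mem_nhds h1) s hs
    have h3 : twistedConv S μ (bump p.1 1 p.2) f s = 0 := by
      rw [twistedConv_apply]
      refine integral_eq_zero_of_ae (.of_forall fun r => ?_)
      by_cases hr : r ∈ tsupport p.1
      · have := hvan r (hp.2.2 hr) s hs
        rw [translate_apply] at this
        simp [convKernel, this]
      · simp [convKernel, bump_apply, image_eq_zero_of_notMem_tsupport hr]
    simp [h2, h3]
  · have hM' : 0 < |M| + 1 := by positivity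
    have hV : ∀ᶠ r in 𝓝 (1 : G), ∀ s, ‖translate S r f s - translate S 1 f s‖
        ≤ ε / 2 / (|M| + 1) := by
      refine eventually_forall_norm_sub_le (F := fun r => translate S r f)
        (continuous_translate S f) (hK.mul f.hasCompactSupport.isCompact) ?_ (by positivity)
      filter_upwards [h1] with r hr s hs using hvan r hr s hs
    filter_upwards [(eventually_deltaFilter μ hV).prod_inl l,
      ((eventually_forall_norm_leftMul_sub_le hM hl f (half_pos hε)).and hM).prod_inr _]
      with p hp hp2 s _
    -- The convolution at `s` is the average, with weight `φ`, of `u α_r(f(r⁻¹s))`; for `r` near `1`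
    -- each term is close to `u f(s)`, uniformly in `s` and in the bounded `u`. Replacing `u f(s)`
    -- by `f(s)` costs the other `ε / 2`.
    have h2 : ‖twistedConv S μ (bump p.1 1 p.2) f s - p.2 * f s‖ ≤ ε / 2 := by
      have : twistedConv S μ (bump p.1 1 p.2) f s
          = ∫ r, p.1 r • (p.2 * translate S r f s) ∂μ := by
        rw [twistedConv_apply]
        refine integral_congr_ae (.of_forall fun r => ?_)
        have : IsScalarTower ℝ A A := ⟨fun c a b => by
          rw [← algebraMap_smul 𝕜 c a, ← algebraMap_smul 𝕜 c (a • b), smul_assoc]⟩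
        simp [convKernel, bump_apply, translate_apply, smul_mul_assoc]
      rw [this]
      refine norm_integral_smul_sub_le μ hp ?_ fun r hr => ?_
      · have := (continuous_translate S f).comp (by fun_prop : Continuous fun r => (r, s))
        exact continuous_const.mul this
      · rw [← mul_sub]
        have h3 := hr s
        rw [translate_one] at h3
        calc ‖p.2 * (translate S r f s - f s)‖ ≤ |M| * (ε / 2 / (|M| + 1)) :=
              (norm_mul_le _ _).trans (mul_le_mul (hp2.2.trans (le_abs_self M)) h3
                (norm_nonneg _) (abs_nonneg _))
          _ ≤ (|M| + 1) * (ε / 2 / (|M| + 1)) := by gcongr; linarith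
          _ = ε / 2 := by field_simp
    have h4 := hp2.1 s
    change ‖twistedConv S μ (bump p.1 1 p.2) f s - f s‖ ≤ ε
    calc _ = ‖(twistedConv S μ (bump p.1 1 p.2) f s - p.2 * f s) + (p.2 * f s - f s)‖ := by
          rw [sub_add_sub_cancel]
      _ ≤ ε / 2 + ε / 2 := (norm_add_le _ _).trans (add_le_add h2 h4)
      _ = ε := add_halves ε

theorem integral_norm_bump (μ : Measure G) [μ.IsHaarMeasure] {φ : C_c(G, ℝ)} {V : Set G}
    (hφ : φ ∈ probDensities μ V) (s : G) (a : A) : ∫ t, ‖bump φ s a t‖ ∂μ = ‖a‖ := by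
  have : ∀ t, ‖bump φ s a t‖ = φ (s⁻¹ * t) * ‖a‖ := fun t => by
    rw [bump_apply, norm_smul, Real.norm_of_nonneg (hφ.1 _)]
  simp only [this]
  rw [integral_mul_const, integral_mul_left_eq_self (fun t => φ t) s⁻¹, hφ.2.1, one_mul]

end Functions

section Reps

variable {𝕜 : Type u} [RCLike 𝕜]
  {A : Type*} [NonUnitalNormedRing A] [NormedSpace 𝕜 A] [NormedSpace ℝ A] [IsScalarTower ℝ 𝕜 A]
  [IsScalarTower 𝕜 A A] [SMulCommClass 𝕜 A A] [CompleteSpace A]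
  {G : Type*} [Group G] [TopologicalSpace G] [IsTopologicalGroup G] [LocallyCompactSpace G]
  [T2Space G] [MeasurableSpace G] [BorelSpace G]
  {S : DynSystem 𝕜 A G}

/-! ## Integrated forms of elementary functions -/

namespace CovRep

variable {X : BanachSpace.{u, v} 𝕜} (ρ : CovRep S X)

theorem U_mul_apply (s t : G) (x : X) : ρ.U (s * t) x = ρ.U s (ρ.U t x) := by
  rw [map_mul]; rfl

theorem U_one_apply (x : X) : ρ.U 1 x = x := by rw [map_one]; rfl

theorem integrated_bump (μ : Measure G) [μ.IsHaarMeasure] (φ : C_c(G, ℝ)) (s : G) (a : A)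
    (x : X) : ρ.integrated μ (bump φ s a) x = ∫ t, φ t • ρ.π a (ρ.U (s * t) x) ∂μ := by
  rw [integrated_apply, ← integral_mul_left_eq_self _ s]
  refine integral_congr_ae (.of_forall fun t => ?_)
  simp only [bump_apply, inv_mul_cancel_left]
  rw [← algebraMap_smul 𝕜 (φ t) a, map_smul, smul_apply, algebraMap_smul]

/-- Recovers `π(a) U_s` from the integrated form alone. Uniqueness, invariant subspaces,
intertwiners and involutivity all rest on this limit. -/
theorem tendsto_integrated_bump (μ : Measure G) [μ.IsHaarMeasure] (s : G) (a : A) (x : X) :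
    Tendsto (fun φ => ρ.integrated μ (bump φ s a) x) (deltaFilter μ) (𝓝 (ρ.π a (ρ.U s x))) := by
  simp only [integrated_bump]
  have := tendsto_integral_deltaFilter μ (h := fun t => ρ.π a (ρ.U (s * t) x))
    (ρ.continuous_comp (by fun_prop) continuous_const continuous_const)
  simpa using this

/-- In every covariant representation, left multiplication and translation of functions become left
factors `π(a)` and `U_r` (see `integrated_translate`). Hence both are bounded for `σ^𝓡`. -/
theorem integrated_leftMul (μ : Measure G) [μ.IsHaarMeasure] (a : A) (f : C_c(G, A)) :
    ρ.integrated μ (leftMul a f) = ρ.π a * ρ.integrated μ f := by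
  ext x
  simp only [mul_apply_eq_comp, integrated_apply]
  rw [← ContinuousLinearMap.integral_comp_comm _ (ρ.integrable μ f x)]
  simp [leftMul_apply, ρ.π_mul]

theorem integrated_translate (μ : Measure G) [μ.IsHaarMeasure] (r : G) (f : C_c(G, A)) :
    ρ.integrated μ (translate S r f) = ρ.U r * ρ.integrated μ f := by
  ext x
  simp only [mul_apply_eq_comp, integrated_apply]
  rw [← ContinuousLinearMap.integral_comp_comm _ (ρ.integrable μ f x),
    ← integral_mul_left_eq_self _ r]
  simp [translate_apply, covariant_apply]

theorem norm_integrated_le (μ : Measure G) [μ.IsHaarMeasure] {C D : ℝ} (hC : 0 ≤ C) (hD : 0 ≤ D)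
    (hπ : ‖ρ.π‖ ≤ C) (hU : ∀ r, ‖ρ.U r‖ ≤ D) (f : C_c(G, A)) :
    ‖ρ.integrated μ f‖ ≤ C * D * ∫ s, ‖f s‖ ∂μ :=
  ContinuousLinearMap.opNorm_le_bound _
    (mul_nonneg (mul_nonneg hC hD) (integral_nonneg fun _ => norm_nonneg _))
    (ρ.norm_integral_le μ f hC hπ fun s _ => hU s)

/-- A bounded approximate left identity of `A` acts as an approximate identity under a
non-degenerate representation. -/
theorem tendsto_π_of_isNonDegenerate (hρ : ρ.IsNonDegenerate) {l : Filter A} {M : ℝ}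
    (hM : ∀ᶠ x in l, ‖x‖ ≤ M) (hl : ∀ a : A, Tendsto (fun x => x * a) l (𝓝 a)) (x : X) :
    Tendsto (fun u => ρ.π u x) l (𝓝 x) := by
  refine tendsto_of_dense_span (F := fun u => ρ.π u) (K := ‖ρ.π‖ * M) ?_
    (ContinuousLinearMap.id 𝕜 X) hρ ?_ x
  · filter_upwards [hM] with u hu
    exact (ρ.π.le_opNorm u).trans (by gcongr)
  · rintro _ ⟨b, x, rfl⟩
    have := (ρ.π.continuous.tendsto b).comp (hl b)
    have h2 := ((ContinuousLinearMap.apply 𝕜 X x).continuous.tendsto _).comp this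
    simpa [Function.comp_def, ρ.π_mul] using h2

end CovRep

end Reps

section LOne

variable {𝕜 : Type u} [RCLike 𝕜]
  {A : Type*} [NonUnitalNormedRing A] [NormedSpace 𝕜 A] [NormedSpace ℝ A] [IsScalarTower ℝ 𝕜 A]
  [IsScalarTower 𝕜 A A] [SMulCommClass 𝕜 A A] [CompleteSpace A]
  {G : Type*} [Group G] [TopologicalSpace G] [IsTopologicalGroup G] [LocallyCompactSpace G]
  [T2Space G] [MeasurableSpace G] [BorelSpace G]

/-! ## The map from `C_c(G, A)` to `L¹(G, A)` -/

variable (𝕜) in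
/-- The class in `L¹(G, A)` of a function in `C_c(G, A)`. -/
def toLOne (μ : Measure G) [μ.IsHaarMeasure] : C_c(G, A) →ₗ[𝕜] Lp A 1 μ where
  toFun f := (f.continuous.memLp_of_hasCompactSupport f.hasCompactSupport).toLp ⇑f
  map_add' _ _ := rfl
  map_smul' _ _ := rfl

theorem coeFn_toLOne (μ : Measure G) [μ.IsHaarMeasure] (f : C_c(G, A)) :
    toLOne 𝕜 μ f =ᵐ[μ] f :=
  MemLp.coeFn_toLp (f.continuous.memLp_of_hasCompactSupport f.hasCompactSupport)

theorem norm_toLOne (μ : Measure G) [μ.IsHaarMeasure] (f : C_c(G, A)) :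
    ‖toLOne 𝕜 μ f‖ = ∫ s, ‖f s‖ ∂μ := by
  rw [L1.norm_eq_integral_norm]
  refine integral_congr_ae ?_
  filter_upwards [coeFn_toLOne (𝕜 := 𝕜) μ f] with s hs
  rw [hs]

/-- It suffices to approximate `c` times the indicator of a set `t` of finite measure. Take `s`
compact in `t`, `V` open around `s`, both with small excess, and a Urysohn function `g` that is `1`
on `s` and `0` off `V`. -/
theorem exists_hasCompactSupport_eLpNorm_sub_le {X : Type*} [TopologicalSpace X] [T2Space X]
    [LocallyCompactSpace X] [MeasurableSpace X] [BorelSpace X] {E : Type*} [NormedAddCommGroup E]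
    [NormedSpace ℝ E] {μ : Measure X} [μ.Regular] {f : X → E} (hf : MemLp f 1 μ) {ε : ENNReal}
    (hε : ε ≠ 0) :
    ∃ g : X → E, eLpNorm (f - g) 1 μ ≤ ε ∧ Continuous g ∧ MemLp g 1 μ ∧ HasCompactSupport g := by
  refine hf.induction_dense ENNReal.one_ne_top _ ?_ ?_ ?_ hε
  rotate_left
  · rintro f g ⟨f_cont, f_mem, hf⟩ ⟨g_cont, g_mem, hg⟩
    exact ⟨f_cont.add g_cont, f_mem.add g_mem, hf.add hg⟩
  · rintro f ⟨-, f_mem, -⟩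
    exact f_mem.aestronglyMeasurable
  intro c t ht htμ ε hε
  obtain ⟨η, ηpos, hη⟩ := exists_eLpNorm_indicator_le (μ := μ) ENNReal.one_ne_top c hε
  have hη2 : (η : ENNReal) / 2 ≠ 0 := (ENNReal.half_pos (ENNReal.coe_pos.2 ηpos).ne').ne'
  obtain ⟨s, st, s_compact, s_closed, μs⟩ := ht.exists_isCompact_isClosed_sdiff_lt htμ.ne hη2
  obtain ⟨V, sV, V_open, -, hV⟩ := s_closed.measurableSet.exists_isOpen_sdiff_lt
    ((measure_mono st).trans_lt htμ).ne hη2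
  obtain ⟨g, hg1, hg0, hgc, hg⟩ := exists_continuous_one_zero_of_isCompact s_compact
    V_open.isClosed_compl (Set.disjoint_compl_right_iff_subset.2 sV)
  have hgcc : HasCompactSupport fun x => g x • c := hgc.smul_right
  have hgcont : Continuous fun x => g x • c := by fun_prop
  refine ⟨fun x => g x • c, ?_, hgcont, hgcont.memLp_of_hasCompactSupport hgcc, hgcc⟩
  -- The error vanishes off `(V \ s) ∪ (t \ s)` and has norm at most `‖c‖` on it; each of the two
  -- pieces has measure at most `η / 2`.
  refine (eLpNorm_mono fun x => ?_).trans (hη ((V \ s) ∪ (t \ s)) ?_)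
  · simp only [Pi.sub_apply]
    by_cases hs : x ∈ s
    · simp [hs, st hs, hg1 hs]
    · by_cases hxV : x ∈ V
      · rw [Set.indicator_of_mem (show x ∈ V \ s ∪ t \ s from Or.inl ⟨hxV, hs⟩)]
        have h1 := (hg x).1
        have h2 := (hg x).2
        by_cases hxt : x ∈ t
        · rw [Set.indicator_of_mem hxt, show g x • c - c = (g x - 1) • c by rw [sub_smul, one_smul], norm_smul]
          refine mul_le_of_le_one_left (norm_nonneg _) ?_
          rw [Real.norm_eq_abs, abs_le]
          constructor <;> linarith
        · rw [Set.indicator_of_notMem hxt, sub_zero, norm_smul]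
          refine mul_le_of_le_one_left (norm_nonneg _) ?_
          rw [Real.norm_eq_abs, abs_le]
          constructor <;> linarith
      · have h0 : g x = 0 := hg0 hxV
        by_cases hxt : x ∈ t
        · rw [Set.indicator_of_mem (show x ∈ V \ s ∪ t \ s from Or.inr ⟨hxt, hs⟩)]
          simp [h0, hxt]
        · simp [h0, hxt]
  · calc _ ≤ μ (V \ s) + μ (t \ s) := measure_union_le _ _
      _ ≤ η / 2 + η / 2 := add_le_add hV.le μs.le
      _ = η := ENNReal.add_halves _

theorem denseRange_toLOne (μ : Measure G) [μ.IsHaarMeasure] [μ.Regular] :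
    DenseRange (toLOne 𝕜 μ : C_c(G, A) → Lp A 1 μ) := by
  intro F
  rw [Metric.mem_closure_iff]
  intro ε hε
  obtain ⟨g, hgε, hgc, hgm, hg⟩ := exists_hasCompactSupport_eLpNorm_sub_le (Lp.memLp F)
    (ε := ENNReal.ofReal (ε / 2)) (by simpa using hε)
  refine ⟨_, ⟨⟨⟨g, hgc⟩, hg⟩, rfl⟩, ?_⟩
  have h1 : toLOne 𝕜 μ (⟨⟨g, hgc⟩, hg⟩ : C_c(G, A)) = hgm.toLp g := rfl
  rw [h1]
  nth_rw 1 [← Lp.toLp_coeFn F (Lp.memLp F)]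
  rw [dist_eq_norm, ← MemLp.toLp_sub, Lp.norm_toLp]
  calc _ ≤ (ENNReal.ofReal (ε / 2)).toReal := ENNReal.toReal_mono ENNReal.ofReal_ne_top hgε
    _ = ε / 2 := ENNReal.toReal_ofReal (half_pos hε).le
    _ < ε := half_lt_self hε

/-- The function `t ↦ f(s) α_s(g(s⁻¹t))`, whose integral over `s` is the twisted convolution. -/
def convSlice (S : DynSystem 𝕜 A G) (f g : C_c(G, A)) (s : G) : C_c(G, A) :=
  leftMul (f s) (translate S s g)

theorem continuous_toLOne_convSlice (μ : Measure G) [μ.IsHaarMeasure] (S : DynSystem 𝕜 A G)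
    (f g : C_c(G, A)) : Continuous fun s => toLOne 𝕜 μ (convSlice S f g s) := by
  rw [continuous_iff_continuousAt]
  intro s
  rw [ContinuousAt, tendsto_iff_norm_sub_tendsto_zero]
  simp only [← map_sub, norm_toLOne]
  refine tendsto_integral_norm_sub_of_continuous μ (F := fun s => convSlice S f g s)
    ((continuous_convKernel S f g).comp continuous_swap)
    (f.hasCompactSupport.isCompact.mul g.hasCompactSupport.isCompact) (.of_forall fun r t ht => ?_)
  by_cases hr : r ∈ tsupport f
  · simp [convSlice, leftMul_apply, translate_eq_zero S g hr ht]
  · simp [convSlice, leftMul_apply, eq_zero_of_notMem_tsupport f hr]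

theorem hasCompactSupport_toLOne_convSlice (μ : Measure G) [μ.IsHaarMeasure]
    (S : DynSystem 𝕜 A G) (f g : C_c(G, A)) :
    HasCompactSupport fun s => toLOne 𝕜 μ (convSlice S f g s) :=
  HasCompactSupport.intro f.hasCompactSupport fun s hs => by
    have : convSlice S f g s = 0 := by
      ext t; simp [convSlice, leftMul_apply, eq_zero_of_notMem_tsupport f hs]
    rw [this, map_zero]

theorem hasCompactSupport_convKernel_swap (S : DynSystem 𝕜 A G) (f g : C_c(G, A)) :
    HasCompactSupport (Function.uncurry fun s t => convKernel S f g t s) := by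
  refine HasCompactSupport.intro (f.hasCompactSupport.isCompact.prod
    (f.hasCompactSupport.isCompact.mul g.hasCompactSupport.isCompact)) ?_
  rintro ⟨r, t⟩ hrt
  by_cases hr : r ∈ tsupport f
  · have ht : t ∉ tsupport f * tsupport g := fun ht => hrt ⟨hr, ht⟩
    have := translate_eq_zero S g hr ht
    rw [translate_apply] at this
    simp [Function.uncurry, convKernel, this]
  · simp [Function.uncurry, convKernel, eq_zero_of_notMem_tsupport f hr]

/-- Integration over `E`, as a bounded functional on `L¹`. -/
def setIntegralL (μ : Measure G) (E : Set G) : Lp A 1 μ →L[ℝ] A where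
  toFun F := ∫ x in E, F x ∂μ
  map_add' F H := by
    rw [← integral_add (L1.integrable_coeFn F).integrableOn (L1.integrable_coeFn H).integrableOn]
    exact integral_congr_ae (ae_restrict_of_ae (Lp.coeFn_add F H))
  map_smul' c F := by
    rw [RingHom.id_apply, ← integral_smul]
    exact integral_congr_ae (ae_restrict_of_ae (Lp.coeFn_smul c F))
  cont := continuous_setIntegral E

/-- Exhibits the convolution as a Bochner integral in `L¹`, under which bounded operators may be
moved. Elements of `L¹` are compared through their integrals over sets `E` of finite measure, and
for each `E` the claim is Fubini for a continuous compactly supported kernel, so no σ-finiteness is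
involved. -/
theorem integral_toLOne_convSlice (μ : Measure G) [μ.IsHaarMeasure] (S : DynSystem 𝕜 A G)
    (f g : C_c(G, A)) :
    ∫ s, toLOne 𝕜 μ (convSlice S f g s) ∂μ = toLOne 𝕜 μ (twistedConv S μ f g) := by
  refine Lp.ext ?_
  refine Lp.ae_eq_of_forall_setIntegral_eq _ _ one_ne_zero ENNReal.one_ne_top
    (fun E _ _ => (L1.integrable_coeFn _).integrableOn)
    (fun E _ _ => (L1.integrable_coeFn _).integrableOn) fun E hE hμE => ?_
  let L := setIntegralL (A := A) μ E
  have hL : ∀ h : C_c(G, A), L (toLOne 𝕜 μ h) = ∫ x in E, h x ∂μ := fun h =>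
    integral_congr_ae (ae_restrict_of_ae (coeFn_toLOne μ h))
  change L _ = L _
  rw [← ContinuousLinearMap.integral_comp_comm L
    ((continuous_toLOne_convSlice μ S f g).integrable_of_hasCompactSupport
      (hasCompactSupport_toLOne_convSlice μ S f g))]
  simp only [hL]
  exact integral_integral_swap_of_hasCompactSupport (f := fun s t => convKernel S f g t s)
    ((continuous_convKernel S f g).comp continuous_swap) (hasCompactSupport_convKernel_swap S f g)

end LOne

section Bounds

variable {𝕜 : Type u} [RCLike 𝕜]
  {A : Type*} [NonUnitalNormedRing A] [NormedSpace 𝕜 A] [NormedSpace ℝ A] [IsScalarTower ℝ 𝕜 A]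
  [IsScalarTower 𝕜 A A] [SMulCommClass 𝕜 A A] [CompleteSpace A]
  {G : Type*} [Group G] [TopologicalSpace G] [IsTopologicalGroup G] [LocallyCompactSpace G]
  [T2Space G] [MeasurableSpace G] [BorelSpace G]
  {S : DynSystem 𝕜 A G}

/-! ## Comparison of `σ^𝓡` with the norm of `L¹(G, A)` -/

namespace UniformlyBoundedClass

variable (R : UniformlyBoundedClass.{u, v} S) (μ : Measure G) [μ.IsHaarMeasure]

theorem exists_norm_π_le : ∃ C : ℝ, 0 ≤ C ∧ ∀ ρ ∈ R.carrier, ‖ρ.2.π‖ ≤ C := by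
  obtain ⟨C, ν, hC, -, -, hb⟩ := R.bounded
  exact ⟨C, hC, fun ρ hρ => (hb ρ hρ).1⟩

theorem norm_U_le_nu {ρ : Σ X : BanachSpace.{u, v} 𝕜, CovRep S X} (hρ : ρ ∈ R.carrier) (r : G) :
    ‖ρ.2.U r‖ ≤ R.nu r := by
  obtain ⟨C, ν, -, -, -, hb⟩ := R.bounded
  refine le_ciSup (f := fun ρ : R.carrier => ‖ρ.1.2.U r‖) ⟨ν r, ?_⟩ ⟨ρ, hρ⟩
  rintro _ ⟨ρ, rfl⟩
  exact (hb _ ρ.2).2 r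

theorem sigma_le_of_forall {f : C_c(G, A)} {c : ℝ}
    (h : ∀ ρ ∈ R.carrier, ‖ρ.2.integrated μ f‖ ≤ c) : R.sigma μ f ≤ c :=
  ciSup_le fun ρ => h _ ρ.2

/-- One half of the equivalence of `σ^𝓡` with the `L¹`-norm; the other half is the hypothesis with
`C₁`. -/
theorem exists_sigma_le {D : ℝ} (hD : 0 ≤ D) (hν : ∀ r, R.nu r ≤ D) :
    ∃ K : ℝ, 0 ≤ K ∧ ∀ f : C_c(G, A), R.sigma μ f ≤ K * ∫ s, ‖f s‖ ∂μ := by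
  obtain ⟨C, hC, hb⟩ := R.exists_norm_π_le
  exact ⟨C * D, mul_nonneg hC hD, fun f => R.sigma_le_of_forall μ fun ρ hρ =>
    ρ.2.norm_integrated_le μ hC hD (hb ρ hρ) (fun r => (R.norm_U_le_nu hρ r).trans (hν r)) f⟩

/-- `q^𝓡` as a linear map. -/
def qₗ : C_c(G, A) →ₗ[𝕜] R.CrossedProduct μ where
  toFun := R.q μ
  map_add' f g := map_add (CrossedProduct.incl R μ) (toCc R μ f) (toCc R μ g)
  map_smul' c f := map_smul (CrossedProduct.incl R μ) c (toCc R μ f)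

theorem qₗ_apply (f : C_c(G, A)) : R.qₗ μ f = R.q μ f := rfl

theorem q_sub (f g : C_c(G, A)) : R.q μ (f - g) = R.q μ f - R.q μ g := map_sub (R.qₗ μ) f g

/-- The isomorphism of `L¹(G, A)` with the crossed product, when `σ^𝓡` is equivalent to the norm
of `L¹`. -/
def lOneEquiv [μ.Regular] (h₁ : ∃ K : ℝ, ∀ f : C_c(G, A), R.sigma μ f ≤ K * ∫ s, ‖f s‖ ∂μ)
    (h₂ : ∃ K : ℝ, ∀ f : C_c(G, A), ∫ s, ‖f s‖ ∂μ ≤ K * R.sigma μ f) :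
    Lp A 1 μ ≃L[𝕜] R.CrossedProduct μ :=
  (LinearEquiv.refl 𝕜 C_c(G, A)).extend (toLOne 𝕜 μ) (R.qₗ μ) (denseRange_toLOne μ)
    (h₁.imp fun K hK f => by simpa [norm_toLOne, qₗ_apply, norm_q] using hK f)
    (R.denseRange_q μ)
    (h₂.imp fun K hK f => by simpa [norm_toLOne, qₗ_apply, norm_q] using hK f)

variable {R μ} in
theorem lOneEquiv_toLOne [μ.Regular]
    (h₁ : ∃ K : ℝ, ∀ f : C_c(G, A), R.sigma μ f ≤ K * ∫ s, ‖f s‖ ∂μ)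
    (h₂ : ∃ K : ℝ, ∀ f : C_c(G, A), ∫ s, ‖f s‖ ∂μ ≤ K * R.sigma μ f) (f : C_c(G, A)) :
    R.lOneEquiv μ h₁ h₂ (toLOne 𝕜 μ f) = R.q μ f :=
  LinearEquiv.extend_eq _ _ _ _ _ _ _ f

/-- `𝓡`-bounded operators commute with the integral that defines the twisted convolution. -/
theorem integral_apply_q_convSlice [μ.Regular]
    (h₁ : ∃ K : ℝ, ∀ f : C_c(G, A), R.sigma μ f ≤ K * ∫ s, ‖f s‖ ∂μ)
    (h₂ : ∃ K : ℝ, ∀ f : C_c(G, A), ∫ s, ‖f s‖ ∂μ ≤ K * R.sigma μ f)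
    {X : BanachSpace.{u, w} 𝕜} (Λ : R.CrossedProduct μ →L[𝕜] X) (f g : C_c(G, A)) :
    ∫ s, Λ (R.q μ (convSlice S f g s)) ∂μ = Λ (R.q μ (twistedConv S μ f g)) := by
  simp only [← lOneEquiv_toLOne h₁ h₂]
  rw [← integral_toLOne_convSlice]
  exact ContinuousLinearMap.integral_comp_comm
    (Λ.comp (R.lOneEquiv μ h₁ h₂ : Lp A 1 μ →L[𝕜] R.CrossedProduct μ))
    ((continuous_toLOne_convSlice μ S f g).integrable_of_hasCompactSupport
      (hasCompactSupport_toLOne_convSlice μ S f g))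

end UniformlyBoundedClass

end Bounds

/-! ## Extending left centralizers to the space of a non-degenerate representation -/

section Centralizers

variable {𝕜 : Type*} [RCLike 𝕜] {X : Type*} [NormedAddCommGroup X] [NormedSpace 𝕜 X]

/-- If `B` has a bounded approximate left identity and `T` is a non-degenerate representation of
`B`, then every left centralizer `L` of `B` determines an operator `V` with `V T(b) = T(L b)`. -/
theorem exists_operator_of_left_centralizer [CompleteSpace X] {B : Type*}
    [NonUnitalSeminormedRing B] [NormedSpace 𝕜 B] (T : B →L[𝕜] X →L[𝕜] X)
    (T_mul : ∀ a b, T (a * b) = T a * T b) (hT : NonDegenerate fun b => T b)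
    {l : Filter B} [l.NeBot] {M : ℝ} (hM : ∀ᶠ e in l, ‖e‖ ≤ M)
    (hl : ∀ b : B, Tendsto (fun e => e * b) l (𝓝 b)) (L : B →L[𝕜] B)
    (hL : ∀ b c, L (b * c) = L b * c) :
    ∃ V : X →L[𝕜] X, (∀ b x, V (T b x) = T (L b) x) ∧ ‖V‖ ≤ ‖T‖ * (‖L‖ * M) := by
  -- `T(L e) T(b) = T(L(e b))` by the centralizer property, and `e b → b`. So `T(L e)` converges on
  -- a set with dense span, and `V` is its strong limit.
  have key : ∀ b x, Tendsto (fun e => T (L e) (T b x)) l (𝓝 (T (L b) x)) := fun b x => by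
    have h1 := ((T.continuous.comp L.continuous).tendsto b).comp (hl b)
    have h2 := ((ContinuousLinearMap.apply 𝕜 X x).continuous.tendsto _).comp h1
    simpa [Function.comp_def, T_mul, hL] using h2
  obtain ⟨V, hV, hVK⟩ := exists_tendsto_of_dense_span (F := fun e => T (L e)) (l := l)
    (K := ‖T‖ * (‖L‖ * M)) (by
      filter_upwards [hM] with e he
      exact (T.le_opNorm _).trans (by gcongr; exact (L.le_opNorm _).trans (by gcongr))) hT
    (by rintro _ ⟨b, x, rfl⟩; exact ⟨_, key b x⟩)
  exact ⟨V, fun b x => tendsto_nhds_unique (hV _) (key b x), hVK⟩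

/-- Transfers non-degeneracy between the representation of the crossed product, its restriction to
`C_c(G, A)`, and `π`. -/
theorem NonDegenerate.of_forall_mem_closure {B B' : Type*} {τ : B → X →L[𝕜] X}
    {τ' : B' → X →L[𝕜] X} (hτ : NonDegenerate τ)
    (h : ∀ b x, τ b x ∈ closure (Submodule.span 𝕜 {y : X | ∃ b x, y = τ' b x} : Set X)) :
    NonDegenerate τ' := by
  have h1 : Submodule.span 𝕜 {y : X | ∃ b x, y = τ b x}
      ≤ (Submodule.span 𝕜 {y : X | ∃ b x, y = τ' b x}).topologicalClosure := by
    rw [Submodule.span_le]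
    rintro _ ⟨b, x, rfl⟩
    exact h b x
  have h2 : Dense (closure (Submodule.span 𝕜 {y : X | ∃ b x, y = τ' b x} : Set X)) :=
    hτ.mono h1
  exact dense_closure.1 h2

end Centralizers

section Correspondence

variable {𝕜 : Type u} [RCLike 𝕜]
  {A : Type*} [NonUnitalNormedRing A] [NormedSpace 𝕜 A] [NormedSpace ℝ A] [IsScalarTower ℝ 𝕜 A]
  [IsScalarTower 𝕜 A A] [SMulCommClass 𝕜 A A] [CompleteSpace A]
  {G : Type*} [Group G] [TopologicalSpace G] [IsTopologicalGroup G] [LocallyCompactSpace G]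
  [T2Space G] [MeasurableSpace G] [BorelSpace G]
  {S : DynSystem 𝕜 A G}

/-! ### Linearity of left multiplications and translations -/

theorem leftMul_add_right (a : A) (f g : C_c(G, A)) :
    leftMul a (f + g) = leftMul a f + leftMul a g := by
  ext t; simp [leftMul_apply, mul_add]

theorem leftMul_smul_right (a : A) (c : 𝕜) (f : C_c(G, A)) :
    leftMul a (c • f) = c • leftMul a f := by
  ext t; simp [leftMul_apply, mul_smul_comm]

theorem leftMul_add_left (a b : A) (f : C_c(G, A)) :
    leftMul (a + b) f = leftMul a f + leftMul b f := by
  ext t; simp [leftMul_apply, add_mul]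

theorem leftMul_smul_left (a : A) (c : 𝕜) (f : C_c(G, A)) :
    leftMul (c • a) f = c • leftMul a f := by
  ext t; simp [leftMul_apply, smul_mul_assoc]

theorem translate_add (S : DynSystem 𝕜 A G) (r : G) (f g : C_c(G, A)) :
    translate S r (f + g) = translate S r f + translate S r g := by
  ext t; simp [translate_apply]

theorem translate_smul (S : DynSystem 𝕜 A G) (r : G) (c : 𝕜) (f : C_c(G, A)) :
    translate S r (c • f) = c • translate S r f := by
  ext t; simp [translate_apply]

/-! ## The action of `A` and of `G` on the seminormed algebra `C_c(G, A)` -/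

namespace UniformlyBoundedClass

variable (R : UniformlyBoundedClass.{u, v} S) (μ : Measure G) [μ.IsHaarMeasure]

theorem exists_sigma_leftMul_le : ∃ C : ℝ, 0 ≤ C ∧
    ∀ a (f : C_c(G, A)), R.sigma μ (leftMul a f) ≤ C * ‖a‖ * R.sigma μ f := by
  obtain ⟨C, hC, hb⟩ := R.exists_norm_π_le
  refine ⟨C, hC, fun a f => R.sigma_le_of_forall μ fun ρ hρ => ?_⟩
  rw [CovRep.integrated_leftMul]
  refine (norm_mul_le _ _).trans ?_
  have h1 : ‖ρ.2.π a‖ ≤ C * ‖a‖ := (ρ.2.π.le_opNorm a).trans (by gcongr; exact hb ρ hρ)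
  exact mul_le_mul h1 (R.norm_integrated_le_sigma μ f ⟨ρ, hρ⟩) (norm_nonneg _) (by positivity)

theorem sigma_translate_le {D : ℝ} (hD : 0 ≤ D) (hν : ∀ r, R.nu r ≤ D) (r : G) (f : C_c(G, A)) :
    R.sigma μ (translate S r f) ≤ D * R.sigma μ f := by
  refine R.sigma_le_of_forall μ fun ρ hρ => ?_
  rw [CovRep.integrated_translate]
  exact (norm_mul_le _ _).trans (mul_le_mul ((R.norm_U_le_nu hρ r).trans (hν r))
    (R.norm_integrated_le_sigma μ f ⟨ρ, hρ⟩) (norm_nonneg _) hD)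

theorem exists_leftMulL : ∃ (C : ℝ) (L : A → CcAlgebra μ R →L[𝕜] CcAlgebra μ R), 0 ≤ C ∧
    (∀ a f, L a (toCc R μ f) = toCc R μ (leftMul a f)) ∧ ∀ a, ‖L a‖ ≤ C * ‖a‖ := by
  obtain ⟨C, hC, hb⟩ := R.exists_sigma_leftMul_le μ
  exact ⟨C, fun a => LinearMap.mkContinuous
    { toFun := fun f : C_c(G, A) => toCc R μ (leftMul a f)
      map_add' := leftMul_add_right a
      map_smul' := leftMul_smul_right a } (C * ‖a‖) (hb a), hC, fun a f => rfl,
    fun a => LinearMap.mkContinuous_norm_le _ (by positivity) _⟩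

theorem exists_translateL {D : ℝ} (hD : 0 ≤ D) (hν : ∀ r, R.nu r ≤ D) :
    ∃ L : G → CcAlgebra μ R →L[𝕜] CcAlgebra μ R,
      (∀ r f, L r (toCc R μ f) = toCc R μ (translate S r f)) ∧ ∀ r, ‖L r‖ ≤ D :=
  ⟨fun r => LinearMap.mkContinuous
    { toFun := fun f : C_c(G, A) => toCc R μ (translate S r f)
      map_add' := translate_add S r
      map_smul' := translate_smul S r } D (R.sigma_translate_le μ hD hν r), fun _ _ => rfl,
    fun _ => LinearMap.mkContinuous_norm_le _ hD _⟩

variable {R μ} in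
@[elab_as_elim]
theorem induction_q {p : R.CrossedProduct μ → Prop} (c : R.CrossedProduct μ)
    (hp : IsClosed {c | p c}) (h : ∀ f : C_c(G, A), p (R.q μ f)) : p c :=
  CrossedProduct.induction R μ c hp h

variable {R μ} in
-- Transports the `L¹`-limits computed for functions to the seminorm `σ^𝓡`.
theorem tendsto_toCc {K : ℝ} (hK : ∀ f : C_c(G, A), R.sigma μ f ≤ K * ∫ s, ‖f s‖ ∂μ)
    {ι : Type*} {l : Filter ι} {F : ι → C_c(G, A)} {f : C_c(G, A)}
    (h : Tendsto (fun i => ∫ s, ‖(F i - f) s‖ ∂μ) l (𝓝 0)) :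
    Tendsto (fun i => toCc R μ (F i)) l (𝓝 (toCc R μ f)) := by
  rw [tendsto_iff_norm_sub_tendsto_zero]
  refine squeeze_zero (fun _ => norm_nonneg _) (fun i => hK (F i - f)) ?_
  simpa using h.const_mul K

/-- `C_c(G, A)` with the seminorm `σ^𝓡` has a bounded approximate left identity. -/
theorem exists_approxLeftIdentity {K : ℝ} (hK0 : 0 ≤ K)
    (hK : ∀ f : C_c(G, A), R.sigma μ f ≤ K * ∫ s, ‖f s‖ ∂μ)
    (hA : HasBoundedApproxLeftIdentity A) :
    ∃ (l : Filter (CcAlgebra μ R)) (M : ℝ), l.NeBot ∧ (∀ᶠ e in l, ‖e‖ ≤ M) ∧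
      ∀ f, Tendsto (fun e => e * f) l (𝓝 f) := by
  obtain ⟨l, hl, ⟨M, hM⟩, hlim⟩ := hA
  refine ⟨(deltaFilter μ ×ˢ l).map fun p => toCc R μ (bump p.1 1 p.2), K * M, inferInstance,
    ?_, fun f => ?_⟩
  · rw [eventually_map]
    filter_upwards [(eventually_deltaFilter μ univ_mem).prod_inl l, hM.prod_inr _] with p hp hpM
    refine (hK (bump p.1 1 p.2)).trans ?_
    rw [integral_norm_bump μ hp]
    gcongr
  · rw [tendsto_map'_iff]
    exact tendsto_toCc (F := fun p : C_c(G, ℝ) × A => twistedConv S μ (bump p.1 1 p.2) f) hK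
      (tendsto_bump_conv S μ hM hlim f)

end UniformlyBoundedClass

/-! ## From representations of the crossed product to covariant representations -/

open UniformlyBoundedClass in
-- Surjectivity of the integration map: `π(a)` and `U_r` are the operators induced by the left
-- centralizers `f ↦ a f` and translation by `r`.
theorem CrossedRep.exists_covRep {R : UniformlyBoundedClass.{u, v} S} {μ : Measure G}
    [μ.IsHaarMeasure] [μ.Regular] (hA : HasBoundedApproxLeftIdentity A)
    {D : ℝ} (hD : 0 ≤ D) (hν : ∀ r, R.nu r ≤ D)
    (h₂ : ∃ K : ℝ, ∀ f : C_c(G, A), ∫ s, ‖f s‖ ∂μ ≤ K * R.sigma μ f)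
    {X : BanachSpace.{u, w} 𝕜} (τ : CrossedRep μ R X) (hτ : τ.IsNonDegenerate) :
    ∃ ρ : CovRep S X, ρ.IsNonDegenerate ∧ ρ.IsUniformlyBounded ∧
      ∀ f, ρ.integrated μ f = τ.T (R.q μ f) := by
  obtain ⟨K, hK0, hK⟩ := R.exists_sigma_le μ hD hν
  obtain ⟨l, M, hl, hM, hlim⟩ := R.exists_approxLeftIdentity μ hK0 hK hA
  obtain ⟨C, LA, hC, hLA, hLAC⟩ := R.exists_leftMulL μ
  obtain ⟨LG, hLG, hLGD⟩ := R.exists_translateL μ hD hν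
  have hM0 : 0 ≤ M := by
    obtain ⟨e, he⟩ := hM.exists
    exact (norm_nonneg _).trans he
  -- Restricting to `C_c(G, A)` keeps non-degeneracy by density, and the centralizers then need to
  -- be defined only on functions.
  let T : CcAlgebra μ R →L[𝕜] X →L[𝕜] X := τ.T.comp (CrossedProduct.incl R μ)
  have T_mul : ∀ f g, T (f * g) = T f * T g := fun f g => by
    change τ.T (CrossedProduct.incl R μ (f * g)) = _
    rw [CrossedProduct.incl_mul, τ.T_mul]
    rfl
  have hT : NonDegenerate fun f => T f := by
    refine NonDegenerate.of_forall_mem_closure hτ fun c x => ?_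
    refine CrossedProduct.induction R μ c ?_ fun f => subset_closure (Submodule.subset_span ?_)
    · exact isClosed_closure.preimage (by fun_prop : Continuous fun c => τ.T c x)
    · exact ⟨f, x, rfl⟩
  have hcont : ∀ x : X, Continuous fun f => T f x := fun x => by fun_prop
  -- Operators that agree on all `T(f) x` are equal. Every algebraic law for `π` and `U` is thereby
  -- reduced to an identity between functions.
  have hext : ∀ {V W : X →L[𝕜] X}, (∀ f x, V (T (toCc R μ f) x) = W (T (toCc R μ f) x)) → V = W :=
    fun h => ContinuousLinearMap.ext_on hT (by rintro _ ⟨f, x, rfl⟩; exact h f x)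
  choose P hP hPK using fun a => exists_operator_of_left_centralizer T T_mul hT hM hlim (LA a)
    (fun f g => (hLA a (twistedConv S μ f g)).trans
      ((leftMul_conv S μ a f g).trans (congrArg (· * g) (hLA a f).symm)))
  choose U hU hUK using fun r => exists_operator_of_left_centralizer T T_mul hT hM hlim (LG r)
    (fun f g => (hLG r (twistedConv S μ f g)).trans
      ((translate_conv S μ r f g).trans (congrArg (· * g) (hLG r f).symm)))
  replace hP : ∀ a f x, P a (T (toCc R μ f) x) = T (toCc R μ (leftMul a f)) x := fun a f x => by
    rw [hP, hLA]
  replace hU : ∀ r f x, U r (T (toCc R μ f) x) = T (toCc R μ (translate S r f)) x :=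
    fun r f x => by rw [hU, hLG]
  have hUD : ∀ r, ‖U r‖ ≤ ‖T‖ * (D * M) := fun r => (hUK r).trans (by gcongr; exact hLGD r)
  have T_add : ∀ f g, T (toCc R μ (f + g)) = T (toCc R μ f) + T (toCc R μ g) :=
    fun f g => map_add T (toCc R μ f) (toCc R μ g)
  have T_smul : ∀ (c : 𝕜) f, T (toCc R μ (c • f)) = c • T (toCc R μ f) :=
    fun c f => map_smul T c (toCc R μ f)
  let π : A →L[𝕜] X →L[𝕜] X := LinearMap.mkContinuous
    { toFun := P
      map_add' := fun a b => hext fun f x => by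
        rw [add_apply, hP, hP, hP, ← add_apply, ← T_add, leftMul_add_left]
      map_smul' := fun c a => hext fun f x => by
        rw [RingHom.id_apply, smul_apply, hP, hP, ← smul_apply, ← T_smul, leftMul_smul_left] } (‖T‖ * (C * M)) fun a =>
    (hPK a).trans (by
      calc ‖T‖ * (‖LA a‖ * M) ≤ ‖T‖ * (C * ‖a‖ * M) := by gcongr; exact hLAC a
        _ = _ := by ring)
  let ρ : CovRep S X :=
    { π := π
      π_mul := fun a b => hext fun f x => by
        change P (a * b) _ = P a (P b _)
        rw [hP, hP, hP, leftMul_leftMul]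
      U :=
        { toFun := U
          map_one' := hext fun f x => by rw [hU, translate_one]; rfl
          map_mul' := fun r s => hext fun f x => by
            rw [mul_apply_eq_comp, hU, hU, hU, translate_translate] }
      -- On vectors `T(f) y` continuity is that of `r ↦ translate S r f` in `L¹`; the uniform bound
      -- `hUD` extends it to all of `X`.
      continuous_U := fun x => by
        rw [continuous_iff_continuousAt]
        intro r
        have key : ∀ (f : C_c(G, A)) y, Tendsto (fun r' => U r' (T (toCc R μ f) y)) (𝓝 r)
            (𝓝 (U r (T (toCc R μ f) y))) := fun f y => by
          simp only [hU]
          exact ((hcont y).tendsto _).comp (tendsto_toCc hK (tendsto_translate S μ f r))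
        refine tendsto_of_dense_span (F := U) (.of_forall hUD) (U r) hT ?_ x
        rintro _ ⟨f, y, rfl⟩
        exact key f y
      covariant := fun s a => hext fun f x => by
        change P (S.act s a) _ = U s (P a (U s⁻¹ _))
        rw [hP, hU, hP, hU, leftMul_act] }
  refine ⟨ρ, ?_, ⟨_, hUD⟩, fun f => hext fun g x => ?_⟩
  -- `T(f) x` is the limit of `T(u f) x = π(u) T(f) x` along the approximate identity of `A`.
  · refine NonDegenerate.of_forall_mem_closure hT fun f x => ?_
    obtain ⟨lA, hlA, ⟨MA, hMA⟩, hlimA⟩ := hA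
    refine mem_closure_of_tendsto (((hcont x).tendsto _).comp (tendsto_toCc hK
      (tendsto_leftMul μ hMA hlimA f))) (.of_forall fun u => Submodule.subset_span ⟨u, T (toCc R μ f) x, ?_⟩)
    exact (hP u f x).symm
  -- On `T(g) x` the integrand `π(f(s)) U_s` gives `T(f(s) α_s(g(s⁻¹ ·))) x`, which integrates to
  -- `T(f * g) x = T(f) T(g) x`.
  · have h := R.integral_apply_q_convSlice μ ⟨K, hK⟩ h₂
      ((ContinuousLinearMap.apply 𝕜 X x).comp τ.T) f g
    have h1 : ρ.integrated μ f (T (toCc R μ g) x) = ∫ s, T (toCc R μ (convSlice S f g s)) x ∂μ := by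
      rw [CovRep.integrated_apply]
      refine integral_congr_ae (.of_forall fun s => ?_)
      change P (f s) (U s _) = _
      rw [hU, hP]
      rfl
    rw [h1]
    refine h.trans ?_
    rw [q_conv, ContinuousLinearMap.comp_apply, τ.T_mul]
    rfl

/-! ## The covariant representation is determined by its integrated form -/

namespace CovRep

variable {μ : Measure G} [μ.IsHaarMeasure] {R : UniformlyBoundedClass.{u, v} S}
  {X X' : BanachSpace.{u, w} 𝕜} {ρ : CovRep S X} {ρ' : CovRep S X'}

theorem isRContinuous (h₂ : ∃ K : ℝ, ∀ f : C_c(G, A), ∫ s, ‖f s‖ ∂μ ≤ K * R.sigma μ f)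
    (hρ : ρ.IsUniformlyBounded) : ρ.IsRContinuous μ R := by
  obtain ⟨K, hK⟩ := h₂
  obtain ⟨D, hD⟩ := hρ
  have hD0 : 0 ≤ D := (norm_nonneg _).trans (hD 1)
  refine ⟨‖ρ.π‖ * D * K, fun f => ?_⟩
  calc ‖ρ.integrated μ f‖ ≤ ‖ρ.π‖ * D * ∫ s, ‖f s‖ ∂μ :=
        ρ.norm_integrated_le μ (norm_nonneg ρ.π) hD0 le_rfl hD f
    _ ≤ ‖ρ.π‖ * D * (K * R.sigma μ f) := by gcongr; exact hK f
    _ = _ := by ring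

theorem isNonDegenerate_integration (h : ρ.IsRContinuous μ R) (hρ : ρ.IsNonDegenerate) :
    (ρ.integration h).IsNonDegenerate := by
  refine NonDegenerate.of_forall_mem_closure hρ fun a x => ?_
  have := ρ.tendsto_integrated_bump μ 1 a x
  rw [U_one_apply] at this
  refine mem_closure_of_tendsto this (.of_forall fun φ => Submodule.subset_span
    ⟨R.q μ (bump φ 1 a), x, ?_⟩)
  rw [integration_q]

/-- Limits along bumps show that `Φ` intertwines the operators `π(a) U_s`. Taking `s = 1` gives `π`,
and an approximate identity then removes `π`. With `Φ` the identity this is the injectivity of the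
integration map. -/
theorem intertwines_of_integrated (hA : HasBoundedApproxLeftIdentity A)
    (hρ : ρ.IsNonDegenerate) (hρ' : ρ'.IsNonDegenerate) {Φ : X →L[𝕜] X'}
    (h : ∀ f x, ρ'.integrated μ f (Φ x) = Φ (ρ.integrated μ f x)) : ρ.Intertwines ρ' Φ := by
  have key : ∀ a s x, ρ'.π a (ρ'.U s (Φ x)) = Φ (ρ.π a (ρ.U s x)) := fun a s x => by
    refine tendsto_nhds_unique (ρ'.tendsto_integrated_bump μ s a (Φ x)) ?_
    simp only [h]
    exact (Φ.continuous.tendsto _).comp (ρ.tendsto_integrated_bump μ s a x)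
  refine ⟨fun a => ?_, fun s => ?_⟩
  · ext x
    simpa [U_one_apply] using key a 1 x
  · ext x
    obtain ⟨l, hl, ⟨M, hM⟩, hlim⟩ := hA
    have h1 := ((ρ'.U s).continuous.tendsto _).comp
      (ρ'.tendsto_π_of_isNonDegenerate hρ' hM hlim (Φ x))
    have h2 := (Φ.continuous.tendsto _).comp (((ρ.U s).continuous.tendsto _).comp
      (ρ.tendsto_π_of_isNonDegenerate hρ hM hlim x))
    refine tendsto_nhds_unique h1 (h2.congr fun u => ?_)
    -- By covariance `U_s π(u) = π(α_s(u)) U_s`, which has the form treated in `key`.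
    have := key (S.act s u) s x
    rw [covariant_apply, covariant_apply] at this
    exact this.symm

theorem intertwines_iff (hA : HasBoundedApproxLeftIdentity A)
    (hρ : ρ.IsNonDegenerate) (hρ' : ρ'.IsNonDegenerate) (h : ρ.IsRContinuous μ R)
    (h' : ρ'.IsRContinuous μ R) (Φ : X →L[𝕜] X') :
    ρ.Intertwines ρ' Φ ↔ (ρ.integration h).Intertwines (ρ'.integration h') Φ := by
  refine ⟨fun hΦ c => ?_, fun hΦ => intertwines_of_integrated (μ := μ) hA hρ hρ' fun f x => ?_⟩
  · refine UniformlyBoundedClass.induction_q c ?_ fun f => ?_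
    · exact isClosed_eq (by fun_prop) (by fun_prop)
    · rw [integration_q, integration_q]
      ext x
      simp only [ContinuousLinearMap.comp_apply, integrated_apply]
      rw [← ContinuousLinearMap.integral_comp_comm _ (ρ.integrable μ f x)]
      refine integral_congr_ae (.of_forall fun s => ?_)
      have h1 : ρ'.U s (Φ x) = Φ (ρ.U s x) := DFunLike.congr_fun (hΦ.2 s) x
      have h2 : ∀ y, ρ'.π (f s) (Φ y) = Φ (ρ.π (f s) y) := DFunLike.congr_fun (hΦ.1 (f s))
      simp only [h1, h2]
  · have := DFunLike.congr_fun (hΦ (R.q μ f)) x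
    rwa [integration_q, integration_q] at this

theorem isInvariant_iff (hA : HasBoundedApproxLeftIdentity A)
    (hρ : ρ.IsNonDegenerate) (h : ρ.IsRContinuous μ R) {Y : Submodule 𝕜 X}
    (hY : IsClosed (Y : Set X)) : ρ.IsInvariant Y ↔ (ρ.integration h).IsInvariant Y := by
  refine ⟨fun hi c y hy => ?_, fun hi => ?_⟩
  · refine UniformlyBoundedClass.induction_q c ?_ fun f => ?_
    · exact hY.preimage (by fun_prop : Continuous fun c => (ρ.integration h).T c y)
    · rw [integration_q, integrated_apply]
      -- A closed `Y` is complete, so the integral can be formed inside `Y`; its image in `X` then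
      -- lies in `Y`.
      have : CompleteSpace (Y.restrictScalars ℝ) := hY.completeSpace_coe
      let F : G → Y.restrictScalars ℝ := fun s =>
        ⟨ρ.π (f s) (ρ.U s y), hi.1 _ _ (hi.2 s y hy)⟩
      have hFc : Continuous F :=
        (ρ.continuous_comp continuous_id f.continuous continuous_const).subtype_mk _
      have hFs : HasCompactSupport F := HasCompactSupport.intro f.hasCompactSupport fun s hs => by
        simp [F, eq_zero_of_notMem_tsupport f hs]
      have := ContinuousLinearMap.integral_comp_comm (Y.restrictScalars ℝ).subtypeL
        (hFc.integrable_of_hasCompactSupport hFs (μ := μ))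
      change ∫ s, (Y.restrictScalars ℝ).subtypeL (F s) ∂μ ∈ Y
      rw [this]
      exact (∫ s, F s ∂μ).2
  · have key : ∀ a s, ∀ y ∈ Y, ρ.π a (ρ.U s y) ∈ Y := fun a s y hy => by
      refine hY.mem_of_tendsto (ρ.tendsto_integrated_bump μ s a y) (.of_forall fun φ => ?_)
      have := hi (R.q μ (bump φ s a)) y hy
      rwa [integration_q] at this
    refine ⟨fun a y hy => by simpa [U_one_apply] using key a 1 y hy, fun s y hy => ?_⟩
    obtain ⟨l, hl, ⟨M, hM⟩, hlim⟩ := hA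
    refine hY.mem_of_tendsto (((ρ.U s).continuous.tendsto _).comp
      (ρ.tendsto_π_of_isNonDegenerate hρ hM hlim y)) (.of_forall fun u => ?_)
    have := key (S.act s u) s y hy
    rwa [covariant_apply] at this

end CovRep

/-! ## The bijection -/

theorem bijOn_integrationMap {R : UniformlyBoundedClass.{u, v} S} {μ : Measure G}
    [μ.IsHaarMeasure] [μ.Regular] (hA : HasBoundedApproxLeftIdentity A)
    {D : ℝ} (hD : 0 ≤ D) (hν : ∀ r, R.nu r ≤ D)
    (h₂ : ∃ K : ℝ, ∀ f : C_c(G, A), ∫ s, ‖f s‖ ∂μ ≤ K * R.sigma μ f)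
    (𝒳 : Set (BanachSpace.{u, w} 𝕜)) :
    Set.BijOn (integrationMap μ R)
      {p | p.1 ∈ 𝒳 ∧ p.2.1.IsNonDegenerate ∧ p.2.1.IsUniformlyBounded}
      {t | t.1 ∈ 𝒳 ∧ t.2.IsNonDegenerate} := by
  refine ⟨fun p hp => ⟨hp.1, CovRep.isNonDegenerate_integration p.2.2 hp.2.1⟩, ?_, ?_⟩
  · rintro ⟨X, ρ, h⟩ hp ⟨X', ρ', h'⟩ hp' heq
    -- Equality of images includes equality of the Banach spaces; after identifying these, the two
    -- covariant representations can be compared.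
    obtain ⟨hX, hT⟩ := Sigma.mk.inj_iff.1 heq
    dsimp only at hX hT
    subst hX
    have hT' : ρ.integration h = ρ'.integration h' := eq_of_heq hT
    have hi := CovRep.intertwines_of_integrated (μ := μ) (ρ := ρ) (ρ' := ρ') hA hp.2.1 hp'.2.1
      (Φ := ContinuousLinearMap.id 𝕜 X) fun f x => by
        have := DFunLike.congr_fun (DFunLike.congr_fun (congrArg CrossedRep.T hT') (R.q μ f)) x
        rw [CovRep.integration_q, CovRep.integration_q] at this
        exact this.symm
    have hπ : ρ'.π = ρ.π := ContinuousLinearMap.ext fun a => by simpa using hi.1 a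
    have hU : ρ'.U = ρ.U := MonoidHom.ext fun s => by simpa using hi.2 s
    obtain rfl : ρ = ρ' := by
      cases ρ; cases ρ'
      simp only at hπ hU
      subst hπ hU
      rfl
    rfl
  · rintro ⟨X, τ⟩ ⟨hX, hτ⟩
    obtain ⟨ρ, hρ, hρb, hρτ⟩ := τ.exists_covRep hA hD hν h₂ hτ
    have h := CovRep.isRContinuous (R := R) (μ := μ) h₂ hρb
    refine ⟨⟨X, ρ, h⟩, ⟨hX, hρ, hρb⟩, ?_⟩
    have hT : (ρ.integration h).T = τ.T := ContinuousLinearMap.ext fun c => by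
      refine UniformlyBoundedClass.induction_q c
        (isClosed_eq (by fun_prop) (by fun_prop)) fun f => ?_
      exact (ρ.integration_q h f).trans (hρτ f)
    change (⟨X, ρ.integration h⟩ : BoundedCrossedRep.{u, v, w} μ R) = ⟨X, τ⟩
    congr 1
    cases τ
    cases hq : ρ.integration h
    rw [hq] at hT
    simp only at hT
    subst hT
    rfl

end Correspondence

/-! ## Inversion and Haar measure -/

section Inversion

variable {G : Type*} [Group G] [TopologicalSpace G] [IsTopologicalGroup G] [LocallyCompactSpace G]
  [T2Space G] [MeasurableSpace G] [BorelSpace G]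

theorem modularFun_pos (r : G) : 0 < modularFun r :=
  inv_pos.2 (NNReal.coe_pos.2 (Measure.modularCharacterFun_pos r))

theorem hasCompactSupport_comp_inv {E : Type*} [Zero E] {f : G → E} (hs : HasCompactSupport f) :
    HasCompactSupport fun s => f s⁻¹ :=
  hs.comp_homeomorph (Homeomorph.inv G)

/-- Uniqueness of Haar measure, comparing the left invariant `μ` with the right invariant `μ.inv`.
The auxiliary `g` cancels, because its integral after right translation by `s⁻¹` is `Δ(s⁻¹)⁻¹` times
its integral. -/
theorem integral_modularFun_inv_mul (μ : Measure G) [μ.IsHaarMeasure] {f : G → ℝ}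
    (hf : Continuous f) (hs : HasCompactSupport f) :
    ∫ s, modularFun s⁻¹ * f s⁻¹ ∂μ = ∫ s, f s ∂μ := by
  obtain ⟨⟨g, hg⟩, hgs, hgn, hg1⟩ :
    ∃ g : C(G, ℝ), HasCompactSupport g ∧ 0 ≤ g ∧ g 1 ≠ 0 := exists_continuous_nonneg_pos 1
  have hgs : HasCompactSupport g := hgs
  have hpos : 0 < ∫ s, g s ∂μ :=
    hg.integral_pos_of_hasCompactSupport_nonneg_nonzero hgs hgn hg1
  have hinv : ∀ h : G → ℝ, ∫ s, h s ∂μ.inv = ∫ s, h s⁻¹ ∂μ := fun h =>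
    (Homeomorph.inv G).measurableEmbedding.integral_map h
  have h := Measure.integral_isMulLeftInvariant_isMulRightInvariant_combo (μ := μ) (ν := μ.inv) hf hs hg
    hgs hgn hg1
  rw [h, hinv, ← integral_mul_const]
  refine integral_congr_ae (.of_forall fun s => ?_)
  simp only [hinv, inv_inv, ← modularCharacter_mul_integral μ hg hgs]
  rw [modularFun]
  field_simp

theorem integral_modularFun_inv_smul (μ : Measure G) [μ.IsHaarMeasure] {E : Type*}
    [NormedAddCommGroup E] [NormedSpace ℝ E] [CompleteSpace E] {f : G → E}
    (hf : Continuous f) (hs : HasCompactSupport f) :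
    ∫ s, modularFun s⁻¹ • f s⁻¹ ∂μ = ∫ s, f s ∂μ := by
  rw [SeparatingDual.eq_iff_forall_dual_eq (R := ℝ)]
  intro L
  have h1 : Integrable (fun s => modularFun s⁻¹ • f s⁻¹) μ :=
    Continuous.integrable_of_hasCompactSupport
      ((continuous_modularFun.comp continuous_inv).smul (hf.comp continuous_inv))
      (hasCompactSupport_comp_inv hs).smul_left
  rw [← ContinuousLinearMap.integral_comp_comm L h1, ← ContinuousLinearMap.integral_comp_comm L
    (hf.integrable_of_hasCompactSupport hs),
    ← integral_modularFun_inv_mul μ (f := fun s => L (f s)) (L.continuous.comp hf)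
      (hs.comp_left (map_zero L))]
  simp

/-- The inverse of a null set is locally null. -/
theorem measure_inter_inv_eq_zero (μ : Measure G) [μ.IsHaarMeasure] [μ.Regular] {N K : Set G}
    (hN : μ N = 0) (hK : IsCompact K) : μ (K ∩ N⁻¹) = 0 := by
  obtain ⟨Q, hQ, hKQ⟩ := exists_compact_superset hK.inv
  obtain ⟨c, hc⟩ := hQ.exists_bound_of_continuousOn
    ((continuous_modularFun (G := G)).comp continuous_inv).continuousOn
  have hc0 : 0 ≤ |c| := abs_nonneg c
  -- Cover `N` by an open set of measure below `ε` and cut it down to `W` near `K⁻¹`, where `Δ(s⁻¹)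
  -- ≤ |c|`. For Urysohn functions supported in `W⁻¹` the inversion formula gives integrals at most
  -- `|c| μ(W)`, and inner regularity turns this into a bound on the measure of `W⁻¹`.
  have key : ∀ ε : ℝ≥0, 0 < ε → μ (K ∩ N⁻¹) ≤ ENNReal.ofReal (|c| * ε) := fun ε hε => by
    obtain ⟨V, hNV, hV, hVε⟩ := N.exists_isOpen_lt_of_lt (μ := μ) ε (by simpa [hN] using hε)
    set W := V ∩ interior Q with hW
    have hWo : IsOpen W := hV.inter isOpen_interior
    have hsub : K ∩ N⁻¹ ⊆ W⁻¹ := fun s hs =>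
      ⟨hNV hs.2, hKQ (Set.inv_mem_inv.2 hs.1)⟩
    refine (measure_mono hsub).trans ?_
    rw [hWo.inv.measure_eq_iSup_isCompact]
    refine iSup₂_le fun K' hK' => iSup_le fun hK'c => ?_
    obtain ⟨f, hf1, hf0, hfc, hf⟩ := exists_continuous_one_zero_of_isCompact hK'c
      hWo.inv.isClosed_compl (Set.disjoint_compl_right_iff_subset.2 hK')
    have hle : μ.real K' ≤ ∫ s, f s ∂μ := by
      calc μ.real K' = ∫ s, K'.indicator 1 s ∂μ := (integral_indicator_one hK'c.measurableSet).symm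
        _ ≤ ∫ s, f s ∂μ := by
          refine integral_mono
            ((integrable_indicator_iff hK'c.measurableSet).2
              (integrableOn_const hK'c.measure_ne_top))
            (f.continuous.integrable_of_hasCompactSupport hfc) fun s => ?_
          by_cases hs : s ∈ K'
          · simp [hs, hf1 hs]
          · simpa [hs] using (hf s).1
    have hμW : μ W ≤ ε := (measure_mono Set.inter_subset_left).trans hVε.le
    have hWtop : μ W ≠ ⊤ := (hμW.trans_lt ENNReal.coe_lt_top).ne
    have hle2 : ∫ s, f s ∂μ ≤ |c| * μ.real W := by
      rw [← integral_modularFun_inv_mul μ f.continuous hfc]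
      calc ∫ s, modularFun s⁻¹ * f s⁻¹ ∂μ ≤ ∫ s, W.indicator (fun _ => |c|) s ∂μ := by
            refine integral_mono ?_ ((integrable_indicator_iff hWo.measurableSet).2
              (integrableOn_const hWtop)) fun s => ?_
            · exact Continuous.integrable_of_hasCompactSupport
                ((continuous_modularFun.comp continuous_inv).mul (f.continuous.comp continuous_inv))
                (hasCompactSupport_comp_inv hfc).mul_left
            · by_cases hs : s ∈ W
              · have h1 : modularFun s⁻¹ ≤ |c| :=
                  (le_abs_self _).trans ((hc s (interior_subset hs.2)).trans (le_abs_self c))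
                rw [Set.indicator_of_mem hs]
                exact (mul_le_of_le_one_right (modularFun_pos _).le (hf _).2).trans h1
              · have h0 : f s⁻¹ = 0 := hf0 fun h => hs (by simpa using h)
                simp [h0, hs]
        _ = |c| * μ.real W := by
            rw [integral_indicator hWo.measurableSet, setIntegral_const, smul_eq_mul, mul_comm]
    have hW' : μ.real W ≤ ε := ENNReal.toReal_mono ENNReal.coe_ne_top hμW
    rw [← ENNReal.ofReal_toReal hK'c.measure_ne_top]
    refine ENNReal.ofReal_le_ofReal (hle.trans (hle2.trans ?_))
    gcongr
  have hlim : Tendsto (fun ε : ℝ≥0 => ENNReal.ofReal (|c| * ε)) (𝓝[>] 0) (𝓝 0) := by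
    have h1 : Continuous fun ε : ℝ≥0 => ENNReal.ofReal (|c| * ε) :=
      ENNReal.continuous_ofReal.comp (by fun_prop)
    simpa using (h1.tendsto 0).mono_left nhdsWithin_le_nhds
  exact le_antisymm (ge_of_tendsto hlim (eventually_nhdsWithin_of_forall key)) zero_le

end Inversion

/-! ## Series in `L¹` -/

section Series

variable {α E ι : Type*} [MeasurableSpace α] {μ : Measure α} [NormedAddCommGroup E]
  [CompleteSpace E] [Countable ι] {F : ι → α → E}

theorem tsum_lintegral_enorm_ne_top (hF : ∀ i, Integrable (F i) μ)
    (hs : Summable fun i => ∫ a, ‖F i a‖ ∂μ) : ∑' i, ∫⁻ a, ‖F i a‖ₑ ∂μ ≠ ⊤ := by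
  have : ∀ i, ∫⁻ a, ‖F i a‖ₑ ∂μ = ENNReal.ofReal (∫ a, ‖F i a‖ ∂μ) := fun i =>
    (ofReal_integral_norm_eq_lintegral_enorm (hF i)).symm
  simp only [this]
  exact hs.tsum_ofReal_ne_top

/-- By Tonelli, the sum of the norms has finite integral and is therefore finite almost everywhere.
-/
theorem ae_summable_norm (hF : ∀ i, Integrable (F i) μ)
    (hs : Summable fun i => ∫ a, ‖F i a‖ ∂μ) : ∀ᵐ a ∂μ, Summable fun i => ‖F i a‖ := by
  have h1 : ∫⁻ a, ∑' i, ‖F i a‖ₑ ∂μ ≠ ⊤ := by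
    rw [lintegral_tsum fun i => (hF i).1.enorm]
    exact tsum_lintegral_enorm_ne_top hF hs
  filter_upwards [ae_lt_top' (AEMeasurable.tsum fun i => (hF i).1.enorm) h1] with a ha
  have := ENNReal.summable_toReal ha.ne
  simpa using this

theorem integrable_and_hasSum_integral [NormedSpace ℝ E] (hF : ∀ i, Integrable (F i) μ)
    (hs : Summable fun i => ∫ a, ‖F i a‖ ∂μ) {g : α → E} (hg : ∀ᵐ a ∂μ, HasSum (F · a) (g a)) :
    Integrable g μ ∧ HasSum (fun i => ∫ a, F i a ∂μ) (∫ a, g a ∂μ) := by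
  constructor
  · refine ⟨aestronglyMeasurable_of_tendsto_ae atTop
      (f := fun (t : Finset ι) a => ∑ i ∈ t, F i a)
      (fun t => Finset.aestronglyMeasurable_fun_sum t fun i _ => (hF i).1) hg, ?_⟩
    have h1 : ∫⁻ a, ∑' i, ‖F i a‖ₑ ∂μ ≠ ⊤ := by
      rw [lintegral_tsum fun i => (hF i).1.enorm]
      exact tsum_lintegral_enorm_ne_top hF hs
    refine (lintegral_mono_ae ?_).trans_lt h1.lt_top
    filter_upwards [hg] with a ha
    rw [← ha.tsum_eq]
    exact enorm_tsum_le_tsum_enorm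
  · have := hasSum_integral_of_summable_integral_norm hF hs
    rwa [integral_congr_ae (g := g) (by filter_upwards [hg] with a ha using ha.tsum_eq)] at this

end Series

section ConvolutionLOne

variable {𝕜 : Type u} [RCLike 𝕜]
  {A : Type*} [NonUnitalNormedRing A] [NormedSpace 𝕜 A] [NormedSpace ℝ A] [IsScalarTower ℝ 𝕜 A]
  [IsScalarTower 𝕜 A A] [SMulCommClass 𝕜 A A] [CompleteSpace A]
  {G : Type*} [Group G] [TopologicalSpace G] [IsTopologicalGroup G] [LocallyCompactSpace G]
  [T2Space G] [MeasurableSpace G] [BorelSpace G]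
  {S : DynSystem 𝕜 A G}

/-! ## Twisted convolution on `L¹(G, A)` -/

variable (𝕜) in
-- The sum in the norm of `L¹` and the almost everywhere pointwise sum have the same integral over
-- every set `E` of finite measure, hence agree almost everywhere.
theorem ae_hasSum_toLOne (μ : Measure G) [μ.IsHaarMeasure] {ι : Type*} [Countable ι]
    {f : ι → C_c(G, A)} {F : Lp A 1 μ} (hf : HasSum (fun i => toLOne 𝕜 μ (f i)) F)
    (hs : Summable fun i => ∫ t, ‖f i t‖ ∂μ) : ∀ᵐ t ∂μ, HasSum (fun i => f i t) (F t) := by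
  have hi : ∀ i, Integrable (f i) μ := fun i =>
    (f i).continuous.integrable_of_hasCompactSupport (f i).hasCompactSupport
  have h1 : ∀ᵐ t ∂μ, HasSum (fun i => f i t) (∑' i, f i t) := by
    filter_upwards [ae_summable_norm hi hs] with t ht using ht.of_norm.hasSum
  obtain ⟨h2, -⟩ := integrable_and_hasSum_integral hi hs h1
  have h4 : F =ᵐ[μ] fun t => ∑' i, f i t := by
    refine Integrable.ae_eq_of_forall_setIntegral_eq _ _ (L1.integrable_coeFn F) h2
      fun E _ _ => ?_
    have h5 := hf.mapL (setIntegralL (A := A) μ E)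
    have h6 : ∀ i, setIntegralL μ E (toLOne 𝕜 μ (f i)) = ∫ t in E, f i t ∂μ := fun i =>
      integral_congr_ae (ae_restrict_of_ae (coeFn_toLOne μ (f i)))
    simp only [h6] at h5
    refine h5.unique (integrable_and_hasSum_integral (fun i => (hi i).restrict) ?_
      (ae_restrict_of_ae h1)).2
    exact .of_nonneg_of_le (fun i => integral_nonneg fun _ => norm_nonneg _)
      (fun i => setIntegral_le_integral (hi i).norm (.of_forall fun _ => norm_nonneg _)) hs
  filter_upwards [h1, h4] with t ht ht'
  rwa [ht']

variable (𝕜) in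
-- By density, `F` is a telescoping sum of elements of `C_c(G, A)` with geometrically decreasing
-- norms.
theorem exists_hasSum_toLOne (μ : Measure G) [μ.IsHaarMeasure] [μ.Regular] (F : Lp A 1 μ) :
    ∃ f : ℕ → C_c(G, A), HasSum (fun n => toLOne 𝕜 μ (f n)) F ∧
      Summable fun n => ∫ t, ‖f n t‖ ∂μ := by
  obtain ⟨v, hv, hvs, -, hvb⟩ := controlled_sum_of_mem_closure
    (s := (LinearMap.range (toLOne 𝕜 μ : C_c(G, A) →ₗ[𝕜] Lp A 1 μ)).toAddSubgroup) (a := F)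
    (denseRange_toLOne (𝕜 := 𝕜) μ F) (b := fun n => (1 / 2 : ℝ) ^ n)
    (fun n => by positivity)
  choose f hf using fun n => LinearMap.mem_range.1 (hvs n)
  have hsum : Summable fun n => ‖v n‖ := by
    -- The geometric bound on `‖v n‖` is available only for `n > 0`, so the first term is split off.
    rw [← summable_nat_add_iff 1]
    exact .of_nonneg_of_le (fun _ => norm_nonneg _) (fun n => (hvb (n + 1) n.succ_pos).le)
      ((summable_nat_add_iff 1).2 summable_geometric_two)
  refine ⟨f, ?_, ?_⟩
  · simp only [hf]
    rw [hsum.of_norm.hasSum_iff_tendsto_nat]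
    exact (tendsto_add_atTop_iff_nat 1).1 hv
  · simp only [← norm_toLOne (𝕜 := 𝕜), hf]
    exact hsum

/-! ### Norm estimates for the convolution kernel -/

theorem translate_bump (S : DynSystem 𝕜 A G) (r s : G) (φ : C_c(G, ℝ)) (a : A) :
    translate S r (bump φ s a) = bump φ (r * s) (S.act r a) := by
  ext t
  simp only [translate_apply, bump_apply, mul_inv_rev, mul_assoc]
  rw [← algebraMap_smul 𝕜 _ a, map_smul, algebraMap_smul]

/-- Strong continuity bounds `α` only on compact sets. A global bound follows because `‖α_r(a)‖` is
the `L¹`-norm of the translate by `r` of a bump with value direction `a`, while translations are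
bounded by `D` for the equivalent seminorm `σ^𝓡`. -/
theorem UniformlyBoundedClass.exists_norm_act_le (R : UniformlyBoundedClass.{u, v} S)
    (μ : Measure G) [μ.IsHaarMeasure] {D : ℝ} (hD : 0 ≤ D) (hν : ∀ r, R.nu r ≤ D) {C₁ : ℝ}
    (hC₁ : 0 ≤ C₁) (hL : ∀ f : C_c(G, A), ∫ s, ‖f s‖ ∂μ ≤ C₁ * R.sigma μ f) :
    ∃ K : ℝ, 0 ≤ K ∧ ∀ r a, ‖S.act r a‖ ≤ K * ‖a‖ := by
  obtain ⟨K, hK0, hK⟩ := R.exists_sigma_le μ hD hν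
  obtain ⟨φ, hφ⟩ := exists_mem_probDensities μ (univ_mem (f := 𝓝 (1 : G)))
  refine ⟨C₁ * (D * K), by positivity, fun r a => ?_⟩
  calc ‖S.act r a‖ = ∫ t, ‖translate S r (bump φ 1 a) t‖ ∂μ := by
        rw [translate_bump, integral_norm_bump μ hφ]
    _ ≤ C₁ * R.sigma μ (translate S r (bump φ 1 a)) := hL _
    _ ≤ C₁ * (D * (K * ∫ t, ‖bump φ 1 a t‖ ∂μ)) := by
        gcongr
        exact (R.sigma_translate_le μ hD hν r _).trans (by gcongr; exact hK _)
    _ = C₁ * (D * K) * ‖a‖ := by rw [integral_norm_bump μ hφ]; ring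

theorem continuous_integral_norm_convKernel (μ : Measure G) [μ.IsHaarMeasure] (f g : C_c(G, A)) :
    Continuous fun s => ∫ r, ‖convKernel S f g s r‖ ∂μ := by
  rw [← continuousOn_univ]
  exact continuousOn_integral_of_compact_support (f := fun s r => ‖convKernel S f g s r‖)
    f.hasCompactSupport (continuous_convKernel S f g).norm.continuousOn
    fun s r _ hr => by simp [convKernel, eq_zero_of_notMem_tsupport f hr]

theorem hasCompactSupport_integral_norm_convKernel (μ : Measure G) [μ.IsHaarMeasure]
    (f g : C_c(G, A)) : HasCompactSupport fun s => ∫ r, ‖convKernel S f g s r‖ ∂μ :=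
  HasCompactSupport.intro (f.hasCompactSupport.isCompact.mul g.hasCompactSupport.isCompact)
    fun s hs => by
      have : ∀ r, ‖convKernel S f g s r‖ = 0 := fun r => by
        by_cases hr : r ∈ tsupport f
        · have h0 := translate_eq_zero S g hr hs
          rw [translate_apply] at h0
          simp [convKernel, h0]
        · simp [convKernel, eq_zero_of_notMem_tsupport f hr]
      simp [this]

theorem integral_integral_norm_convKernel_le (μ : Measure G) [μ.IsHaarMeasure] {K : ℝ}
    (hK : ∀ r a, ‖S.act r a‖ ≤ K * ‖a‖) (f g : C_c(G, A)) :
    ∫ s, ∫ r, ‖convKernel S f g s r‖ ∂μ ∂μ ≤ K * ((∫ r, ‖f r‖ ∂μ) * ∫ s, ‖g s‖ ∂μ) := by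
  have h1 : ∫ s, ∫ r, ‖convKernel S f g s r‖ ∂μ ∂μ
      = ∫ r, ∫ s, ‖convKernel S f g s r‖ ∂μ ∂μ :=
    (integral_integral_swap_of_hasCompactSupport (f := fun r s => ‖convKernel S f g s r‖)
      ((continuous_convKernel S f g).norm.comp continuous_swap)
      (hasCompactSupport_convKernel_swap S f g).norm).symm
  rw [h1, ← integral_mul_const, ← integral_const_mul]
  refine integral_mono_of_nonneg (.of_forall fun r => integral_nonneg fun _ => norm_nonneg _)
    (((integrable_norm_cc μ f).mul_const _).const_mul _) (.of_forall fun r => ?_)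
  simp only
  rw [← integral_mul_left_eq_self (fun s => ‖convKernel S f g s r‖) r,
    ← mul_assoc, mul_comm K, mul_assoc, ← integral_const_mul, ← integral_const_mul]
  refine integral_mono_of_nonneg (.of_forall fun s => norm_nonneg _)
    (((integrable_norm_cc μ g).const_mul _).const_mul _) (.of_forall fun s => ?_)
  simp only [convKernel, inv_mul_cancel_left]
  exact (norm_mul_le _ _).trans (by gcongr; exact hK _ _)

/-- The product of absolutely convergent series converges to the product of the sums. -/
theorem hasSum_mul_of_summable_norm {B : Type*} [NonUnitalNormedRing B] [CompleteSpace B]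
    {f g : ℕ → B} {a b : B} (hf : HasSum f a) (hf' : Summable fun n => ‖f n‖) (hg : HasSum g b)
    (hg' : Summable fun n => ‖g n‖) : HasSum (fun p : ℕ × ℕ => f p.1 * g p.2) (a * b) := by
  exact hf.mul hg (.of_norm_bounded (hf'.mul_of_nonneg hg' (fun _ => norm_nonneg _)
    fun _ => norm_nonneg _) fun p => norm_mul_le _ _)

/-- For every `s`, the series for `F(r) α_r(H(r⁻¹s))` that is obtained from series for `F` and `H`
in `C_c(G, A)` converges for almost all `r`. -/
theorem ae_hasSum_convKernel (μ : Measure G) [μ.IsHaarMeasure] [μ.Regular] {K : ℝ}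
    (hK : ∀ r a, ‖S.act r a‖ ≤ K * ‖a‖) {F H : Lp A 1 μ} {f h : ℕ → C_c(G, A)}
    (hf : HasSum (fun n => toLOne 𝕜 μ (f n)) F) (hfs : Summable fun n => ∫ t, ‖f n t‖ ∂μ)
    (hh : HasSum (fun n => toLOne 𝕜 μ (h n)) H) (hhs : Summable fun n => ∫ t, ‖h n t‖ ∂μ) (s : G) :
    ∀ᵐ r ∂μ, HasSum (fun p : ℕ × ℕ => convKernel S (f p.1) (h p.2) s r)
      (F r * S.act r (H (r⁻¹ * s))) := by
  have hi : ∀ f : C_c(G, A), Integrable f μ := fun f =>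
    f.continuous.integrable_of_hasCompactSupport f.hasCompactSupport
  have hF := (ae_hasSum_toLOne 𝕜 μ hf hfs).and (ae_summable_norm (fun n => hi (f n)) hfs)
  have hH := (ae_hasSum_toLOne 𝕜 μ hh hhs).and (ae_summable_norm (fun n => hi (h n)) hhs)
  set N : Set G := {t | ¬(HasSum (fun n => h n t) (H t) ∧ Summable fun n => ‖h n t‖)} with hN
  have hN0 : μ N = 0 := hH
  -- The exceptional `r` lie in `s N⁻¹`. Only those in the compact support of some `f n` matter, and
  -- there the inverse of a null set is null.
  have hnull : ∀ n, ∀ᵐ r ∂μ, r ∈ tsupport (f n) → r⁻¹ * s ∉ N := fun n => by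
    have h1 := measure_inter_inv_eq_zero μ hN0
      ((f n).hasCompactSupport.isCompact.smul s⁻¹)
    rw [← measure_smul μ s] at h1
    refine measure_mono_null (fun r hr => ?_) h1
    simp only [Set.mem_compl_iff, Set.mem_ofPred_eq, not_forall, not_not] at hr
    obtain ⟨hr1, hr2⟩ := hr
    rw [Set.mem_smul_set_iff_inv_smul_mem]
    exact ⟨Set.smul_mem_smul_set hr1, by simpa using hr2⟩
  filter_upwards [hF, ae_all_iff.2 hnull] with r hr hrn
  by_cases hex : ∃ n, r ∈ tsupport (f n)
  · obtain ⟨n, hn⟩ := hex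
    have h1 : HasSum (fun n => h n (r⁻¹ * s)) (H (r⁻¹ * s)) ∧
        Summable fun n => ‖h n (r⁻¹ * s)‖ := not_not.1 (hrn n hn)
    have h3 : HasSum (fun n => S.act r (h n (r⁻¹ * s))) (S.act r (H (r⁻¹ * s))) :=
      h1.1.mapL (S.act r)
    have h2 : Summable fun m => ‖S.act r (h m (r⁻¹ * s))‖ :=
      .of_nonneg_of_le (fun _ => norm_nonneg _) (fun m => hK r _) (h1.2.mul_left K)
    exact hasSum_mul_of_summable_norm (f := fun n => f n r)
      (g := fun n => S.act r (h n (r⁻¹ * s))) hr.1 hr.2 h3 h2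
  -- Outside all supports every `f n r` vanishes, hence so does `F r`, and the behaviour of `H` at
  -- `r⁻¹ * s` is irrelevant.
  · push Not at hex
    have h0 : ∀ n, f n r = 0 := fun n => eq_zero_of_notMem_tsupport (f n) (hex n)
    have hF0 : F r = 0 := hr.1.unique (by simp [h0])
    simp [convKernel, h0, hF0, hasSum_zero]

/-- Expand `F` and `H` in series from `C_c(G, A)`. The double series of convolutions has sum `Ψ.symm
(Ψ F * Ψ H)` in `L¹`, and pointwise almost everywhere its sum is the convolution integral; the two
sums agree. -/
theorem lOneEquiv_symm_mul (R : UniformlyBoundedClass.{u, v} S) (μ : Measure G) [μ.IsHaarMeasure]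
    [μ.Regular] {D : ℝ} (hD : 0 ≤ D) (hν : ∀ r, R.nu r ≤ D) {C₁ : ℝ}
    (hC₁ : 0 ≤ C₁) (hL : ∀ f : C_c(G, A), ∫ s, ‖f s‖ ∂μ ≤ C₁ * R.sigma μ f)
    (Ψ : Lp A 1 μ ≃L[𝕜] R.CrossedProduct μ) (hΨ : ∀ f, Ψ (toLOne 𝕜 μ f) = R.q μ f)
    (F H : Lp A 1 μ) :
    (∀ᵐ s ∂μ, Integrable (fun r => F r * S.act r (H (r⁻¹ * s))) μ) ∧
      Ψ.symm (Ψ F * Ψ H) =ᵐ[μ] twistedConvFun S μ F H := by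
  obtain ⟨K, -, hK⟩ := R.exists_norm_act_le μ hD hν hC₁ hL
  obtain ⟨K', -, hK'⟩ := R.exists_sigma_le μ hD hν
  obtain ⟨f, hf, hfs⟩ := exists_hasSum_toLOne 𝕜 μ F
  obtain ⟨h, hh, hhs⟩ := exists_hasSum_toLOne 𝕜 μ H
  have hk := ae_hasSum_convKernel (S := S) μ hK hf hfs hh hhs
  have hprod : Summable fun p : ℕ × ℕ => (∫ t, ‖f p.1 t‖ ∂μ) * ∫ t, ‖h p.2 t‖ ∂μ :=
    hfs.mul_of_nonneg hhs (fun _ => integral_nonneg fun _ => norm_nonneg _)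
      (fun _ => integral_nonneg fun _ => norm_nonneg _)
  have hsum : Summable fun p : ℕ × ℕ =>
      ∫ s, ∫ r, ‖convKernel S (f p.1) (h p.2) s r‖ ∂μ ∂μ :=
    .of_nonneg_of_le (fun _ => integral_nonneg fun _ => integral_nonneg fun _ => norm_nonneg _)
      (fun p => integral_integral_norm_convKernel_le μ hK (f p.1) (h p.2)) (hprod.mul_left K)
  have hnn : ∀ (p : ℕ × ℕ) s, 0 ≤ ∫ r, ‖convKernel S (f p.1) (h p.2) s r‖ ∂μ := fun p s =>
    integral_nonneg fun _ => norm_nonneg _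
  have hae := ae_summable_norm (μ := μ)
    (F := fun (p : ℕ × ℕ) s => ∫ r, ‖convKernel S (f p.1) (h p.2) s r‖ ∂μ)
    (fun p => (continuous_integral_norm_convKernel μ _ _).integrable_of_hasCompactSupport
      (hasCompactSupport_integral_norm_convKernel μ _ _))
    (by simpa only [Real.norm_of_nonneg (hnn _ _)] using hsum)
  simp only [Real.norm_of_nonneg (hnn _ _)] at hae
  have hi : ∀ (p : ℕ × ℕ) s, Integrable (convKernel S (f p.1) (h p.2) s) μ :=
    fun p s => integrable_convKernel S μ (f p.1) (h p.2) s
  -- For almost every `s` the kernels are absolutely summable in `L¹` of the variable `r`, so the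
  -- sum may be integrated term by term.
  have hboth : ∀ᵐ s ∂μ, Integrable (fun r => F r * S.act r (H (r⁻¹ * s))) μ ∧
      HasSum (fun p : ℕ × ℕ => twistedConv S μ (f p.1) (h p.2) s) (twistedConvFun S μ F H s) := by
    filter_upwards [hae] with s hs
    exact integrable_and_hasSum_integral (fun p => hi p s) hs (hk s)
  refine ⟨hboth.mono fun s hs => hs.1, ?_⟩
  have hq : ∀ {F : Lp A 1 μ} {f : ℕ → C_c(G, A)}, HasSum (fun n => toLOne 𝕜 μ (f n)) F →
      HasSum (fun n => R.q μ (f n)) (Ψ F) := fun hf => by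
    simpa [hΨ] using hf.mapL (Ψ : Lp A 1 μ →L[𝕜] R.CrossedProduct μ)
  have hqs : ∀ {f : ℕ → C_c(G, A)}, (Summable fun n => ∫ t, ‖f n t‖ ∂μ) →
      Summable fun n => ‖R.q μ (f n)‖ := fun hf =>
    .of_nonneg_of_le (fun _ => norm_nonneg _) (fun n => (R.norm_q μ _).trans_le (hK' _))
      (hf.mul_left K')
  have h1 : HasSum (fun p : ℕ × ℕ => toLOne 𝕜 μ (twistedConv S μ (f p.1) (h p.2)))
      (Ψ.symm (Ψ F * Ψ H)) := by
    have := (hasSum_mul_of_summable_norm (hq hf) (hqs hfs) (hq hh) (hqs hhs)).mapL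
      (Ψ.symm : R.CrossedProduct μ →L[𝕜] Lp A 1 μ)
    refine this.congr_fun fun p => ?_
    change toLOne 𝕜 μ (twistedConv S μ (f p.1) (h p.2)) = Ψ.symm (R.q μ (f p.1) * R.q μ (h p.2))
    rw [← UniformlyBoundedClass.q_conv, ← hΨ, ContinuousLinearEquiv.symm_apply_apply]
  have h2 : Summable fun p : ℕ × ℕ => ∫ s, ‖twistedConv S μ (f p.1) (h p.2) s‖ ∂μ := by
    refine .of_nonneg_of_le (fun _ => integral_nonneg fun _ => norm_nonneg _) (fun p => ?_) hsum
    exact integral_mono (integrable_norm_cc μ _)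
      ((continuous_integral_norm_convKernel μ _ _).integrable_of_hasCompactSupport
        (hasCompactSupport_integral_norm_convKernel μ _ _))
      fun s => norm_integral_le_integral_norm _
  filter_upwards [ae_hasSum_toLOne 𝕜 μ h1 h2, hboth] with s hs hs'
  exact hs.unique hs'.2

end ConvolutionLOne

section Involutive

variable {𝕜 : Type u} [RCLike 𝕜]
  {A : Type*} [NonUnitalNormedRing A] [NormedSpace 𝕜 A] [NormedSpace ℝ A] [IsScalarTower ℝ 𝕜 A]
  [IsScalarTower 𝕜 A A] [SMulCommClass 𝕜 A A] [CompleteSpace A]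
  {G : Type*} [Group G] [TopologicalSpace G] [IsTopologicalGroup G] [LocallyCompactSpace G]
  [T2Space G] [MeasurableSpace G] [BorelSpace G]
  {S : DynSystem 𝕜 A G}

/-! ## Inner products on Banach spaces -/

/-- The normed space structure is a variable here so that it can be replaced by the one of the inner
product; for the fixed structure of a `BanachSpace` this substitution is not possible. -/
theorem exists_inner_eq {𝕜 X : Type*} [RCLike 𝕜] {hX : NormedAddCommGroup X} {ns : NormedSpace 𝕜 X}
    {h : InnerProductSpace 𝕜 X} (hh : h.toNormedSpace = ns) (y : X) :
    ∃ L : X →L[𝕜] 𝕜, ∀ x, L x = h.inner y x := by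
  subst hh
  exact ⟨innerSL 𝕜 y, fun x => rfl⟩

theorem exists_inner_clm {X : BanachSpace.{u, v} 𝕜} {h : InnerProductSpace 𝕜 X}
    (hh : h.toNormedSpace = X.normedSpace) (y : X) :
    ∃ L : X →L[𝕜] 𝕜, ∀ x, L x = h.inner y x :=
  exists_inner_eq hh y

/-! ## The involution on `C_c(G, A)` -/

section Star

variable [StarRing A] [StarModule 𝕜 A] [ContinuousStar A]

theorem starCc_apply (f : C_c(G, A)) (s : G) :
    starCc S f s = modularFun s⁻¹ • S.act s (star (f s⁻¹)) := rfl

theorem starCc_add (f g : C_c(G, A)) : starCc S (f + g) = starCc S f + starCc S g := by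
  ext s
  simp [starCc_apply]

theorem starCc_smul (c : 𝕜) (f : C_c(G, A)) : starCc S (c • f) = star c • starCc S f := by
  ext s
  rw [CompactlySupportedContinuousMap.smul_apply, starCc_apply, starCc_apply,
    CompactlySupportedContinuousMap.smul_apply, star_smul, map_smul,
    ← algebraMap_smul 𝕜 (modularFun s⁻¹), ← algebraMap_smul 𝕜 (modularFun s⁻¹), smul_comm]

theorem star_real_smul (𝕜 : Type*) [RCLike 𝕜] {A : Type*} [NonUnitalNormedRing A] [NormedSpace 𝕜 A]
    [NormedSpace ℝ A] [IsScalarTower ℝ 𝕜 A] [StarRing A] [StarModule 𝕜 A] (r : ℝ) (a : A) :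
    star (r • a) = r • star a := by
  rw [← algebraMap_smul 𝕜 r a, ← algebraMap_smul 𝕜 r (star a), star_smul]
  congr 1
  exact RCLike.conj_ofReal r

namespace CovRep

variable {X : BanachSpace.{u, v} 𝕜} (ρ : CovRep S X)

theorem U_U_inv (s : G) (x : X) : ρ.U s (ρ.U s⁻¹ x) = x := by
  rw [← U_mul_apply, mul_inv_cancel, U_one_apply]

theorem continuous_U_inv_star (f : C_c(G, A)) (y : X) :
    Continuous fun s => ρ.U s⁻¹ (ρ.π (star (f s)) y) :=
  (continuous_uncurry_of_strong ρ.U ρ.continuous_U).comp (continuous_inv.prodMk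
    ((ρ.π.continuous.comp (continuous_star.comp f.continuous)).clm_apply continuous_const))

theorem hasCompactSupport_U_inv_star (f : C_c(G, A)) (y : X) :
    HasCompactSupport fun s => ρ.U s⁻¹ (ρ.π (star (f s)) y) :=
  HasCompactSupport.intro f.hasCompactSupport fun s hs => by
    simp [eq_zero_of_notMem_tsupport f hs]

/-- Inversion on `G` absorbs the modular function, and covariance turns `π(α_s(a*)) U_s` into `U_s
π(a*)`. The integrand on the right is the formal adjoint of `π(f(s)) U_s`. -/
theorem integrated_starCc (μ : Measure G) [μ.IsHaarMeasure] (f : C_c(G, A)) (y : X) :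
    ρ.integrated μ (starCc S f) y = ∫ s, ρ.U s⁻¹ (ρ.π (star (f s)) y) ∂μ := by
  rw [← integral_modularFun_inv_smul μ (ρ.continuous_U_inv_star f y)
    (ρ.hasCompactSupport_U_inv_star f y), integrated_apply]
  refine integral_congr_ae (.of_forall fun s => ?_)
  simp only [starCc_apply, inv_inv]
  rw [← algebraMap_smul 𝕜 (modularFun s⁻¹) (S.act s (star (f s⁻¹))), map_smul, smul_apply,
    algebraMap_smul, covariant_apply]

theorem tendsto_integrated_starCc_bump (μ : Measure G) [μ.IsHaarMeasure] (s : G) (a : A) (y : X) :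
    Tendsto (fun φ => ρ.integrated μ (starCc S (bump φ s a)) y) (deltaFilter μ)
      (𝓝 (ρ.U s⁻¹ (ρ.π (star a) y))) := by
  have h1 : ∀ φ : C_c(G, ℝ), ρ.integrated μ (starCc S (bump φ s a)) y
      = ∫ t, φ t • ρ.U (s * t)⁻¹ (ρ.π (star a) y) ∂μ := fun φ => by
    rw [integrated_starCc, ← integral_mul_left_eq_self _ s]
    refine integral_congr_ae (.of_forall fun t => ?_)
    simp only [bump_apply, inv_mul_cancel_left]
    rw [star_real_smul 𝕜, ← algebraMap_smul 𝕜 (φ t) (star a), map_smul, smul_apply,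
      map_smul, algebraMap_smul]
  simp only [h1]
  have := tendsto_integral_deltaFilter μ (h := fun t => ρ.U (s * t)⁻¹ (ρ.π (star a) y))
    ((ρ.continuous_U _).comp (by fun_prop))
  simpa using this

variable {ρ} in
/-- `π ⋊ U (f)* = π ⋊ U (f*)` for an involutive covariant representation. -/
theorem inner_integrated (μ : Measure G) [μ.IsHaarMeasure] {h : InnerProductSpace 𝕜 X}
    (hh : h.toNormedSpace = X.normedSpace)
    (hπ : ∀ a x y, h.inner (ρ.π a x) y = h.inner x (ρ.π (star a) y))
    (hU : ∀ s x y, h.inner (ρ.U s x) (ρ.U s y) = h.inner x y) (f : C_c(G, A)) (x y : X) :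
    h.inner (ρ.integrated μ f x) y = h.inner x (ρ.integrated μ (starCc S f) y) := by
  obtain ⟨L, hL⟩ := exists_inner_clm hh x
  obtain ⟨L', hL'⟩ := exists_inner_clm hh y
  rw [← hL, integrated_starCc, ← ContinuousLinearMap.integral_comp_comm L
    ((ρ.continuous_U_inv_star f y).integrable_of_hasCompactSupport
      (ρ.hasCompactSupport_U_inv_star f y))]
  rw [← h.conj_inner_symm, ← hL', integrated_apply,
    ← ContinuousLinearMap.integral_comp_comm L' (ρ.integrable μ f x), ← integral_conj]
  refine integral_congr_ae (.of_forall fun s => ?_)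
  simp only [hL, hL']
  rw [h.conj_inner_symm, hπ, ← hU s x, U_U_inv]

variable {ρ} in
-- Limits along bumps show that `π(a) U_s` has adjoint `U_s⁻¹ π(a*)`. The case `s = 1` settles `π`;
-- for `U`, the functionals `⟨U_s x, ·⟩` and `⟨x, U_s⁻¹ ·⟩` agree on all `π(b) z`, hence everywhere
-- by non-degeneracy.
theorem inner_of_integrated (μ : Measure G) [μ.IsHaarMeasure] (hρ : ρ.IsNonDegenerate)
    {h : InnerProductSpace 𝕜 X} (hh : h.toNormedSpace = X.normedSpace)
    (hf : ∀ f x y, h.inner (ρ.integrated μ f x) y = h.inner x (ρ.integrated μ (starCc S f) y)) :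
    (∀ a x y, h.inner (ρ.π a x) y = h.inner x (ρ.π (star a) y)) ∧
      ∀ s x y, h.inner (ρ.U s x) (ρ.U s y) = h.inner x y := by
  have key : ∀ s a x y, h.inner (ρ.π a (ρ.U s x)) y = h.inner x (ρ.U s⁻¹ (ρ.π (star a) y)) :=
      fun s a x y => by
    obtain ⟨L, hL⟩ := exists_inner_clm hh x
    obtain ⟨L', hL'⟩ := exists_inner_clm hh y
    rw [← hL, ← h.conj_inner_symm, ← hL']
    have h1 := ((RCLike.continuous_conj.comp L'.continuous).tendsto _).comp
      (ρ.tendsto_integrated_bump μ s a x)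
    have h2 := (L.continuous.tendsto _).comp (ρ.tendsto_integrated_starCc_bump μ s a y)
    refine tendsto_nhds_unique h1 (h2.congr fun φ => ?_)
    simp only [Function.comp_apply, hL, hL', h.conj_inner_symm, hf]
  have hπ : ∀ a x y, h.inner (ρ.π a x) y = h.inner x (ρ.π (star a) y) := fun a x y => by
    simpa [U_one_apply] using key 1 a x y
  refine ⟨hπ, fun s x y => ?_⟩
  obtain ⟨L, hL⟩ := exists_inner_clm hh x
  obtain ⟨L', hL'⟩ := exists_inner_clm hh (ρ.U s x)
  have hLL : L' = L.comp (ρ.U s⁻¹) := by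
    refine ContinuousLinearMap.ext_on hρ ?_
    rintro _ ⟨b, z, rfl⟩
    simp only [ContinuousLinearMap.comp_apply, hL, hL']
    rw [← star_star b, ← hπ, key]
  rw [← hL', hLL, ContinuousLinearMap.comp_apply, ← U_mul_apply, inv_mul_cancel, U_one_apply, hL]

theorem norm_integrated_starCc_le (μ : Measure G) [μ.IsHaarMeasure] (hρ : ρ.IsInvolutive)
    (f : C_c(G, A)) : ‖ρ.integrated μ (starCc S f)‖ ≤ ‖ρ.integrated μ f‖ := by
  obtain ⟨h, hh, hπ, hU⟩ := hρ
  have hf := inner_integrated μ hh hπ hU f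
  refine ContinuousLinearMap.opNorm_le_bound _ (norm_nonneg _) fun y => ?_
  set z := ρ.integrated μ (starCc S f) y with hz
  -- `⟨z, z⟩ = ⟨π ⋊ U (f) z, y⟩`, followed by Cauchy–Schwarz.
  have h1 : ‖z‖ * ‖z‖ ≤ ‖ρ.integrated μ f‖ * ‖y‖ * ‖z‖ := by
    rw [← inner_self_eq_norm_mul_norm (𝕜 := 𝕜) z]
    refine (RCLike.re_le_norm _).trans ?_
    have : h.inner z z = h.inner (ρ.integrated μ f z) y := (hf z y).symm
    rw [show inner 𝕜 z z = h.inner z z from rfl, this]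
    refine (norm_inner_le_norm _ _).trans ?_
    calc _ ≤ ‖ρ.integrated μ f‖ * ‖z‖ * ‖y‖ := by
          gcongr; exact (ρ.integrated μ f).le_opNorm z
      _ = _ := by ring
  rcases (norm_nonneg z).eq_or_lt with h0 | h0
  · rw [← h0]; positivity
  · exact le_of_mul_le_mul_right h1 h0

theorem sq_norm_integrated_le (μ : Measure G) [μ.IsHaarMeasure] (hρ : ρ.IsInvolutive)
    (f : C_c(G, A)) :
    ‖ρ.integrated μ f‖ ^ 2 ≤ ‖ρ.integrated μ (twistedConv S μ (starCc S f) f)‖ := by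
  obtain ⟨h, hh, hπ, hU⟩ := hρ
  have hf := inner_integrated μ hh hπ hU f
  set c := ‖ρ.integrated μ (twistedConv S μ (starCc S f) f)‖ with hc
  have h1 : ‖ρ.integrated μ f‖ ≤ √c := by
    refine ContinuousLinearMap.opNorm_le_bound _ (Real.sqrt_nonneg _) fun x => ?_
    have h2 : ‖ρ.integrated μ f x‖ ^ 2 ≤ c * ‖x‖ ^ 2 := by
      rw [← inner_self_eq_norm_sq (𝕜 := 𝕜)]
      refine (RCLike.re_le_norm _).trans ?_
      have : h.inner (ρ.integrated μ f x) (ρ.integrated μ f x)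
          = h.inner x (ρ.integrated μ (twistedConv S μ (starCc S f) f) x) := by
        rw [hf, integrated_conv]; rfl
      rw [show inner 𝕜 (ρ.integrated μ f x) (ρ.integrated μ f x) = h.inner _ _ from rfl, this]
      refine (norm_inner_le_norm _ _).trans ?_
      calc _ ≤ ‖x‖ * (c * ‖x‖) := by
            gcongr; exact (ρ.integrated μ _).le_opNorm x
        _ = _ := by ring
    calc ‖ρ.integrated μ f x‖ ≤ √(c * ‖x‖ ^ 2) := Real.le_sqrt_of_sq_le h2
      _ = √c * ‖x‖ := by
        rw [Real.sqrt_mul (norm_nonneg _), Real.sqrt_sq (norm_nonneg _)]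
  calc ‖ρ.integrated μ f‖ ^ 2 ≤ √c ^ 2 := by gcongr
    _ = c := Real.sq_sqrt (norm_nonneg _)

theorem integrated_starCc_conv (μ : Measure G) [μ.IsHaarMeasure] (hρ : ρ.IsInvolutive)
    (f g : C_c(G, A)) : ρ.integrated μ (starCc S (twistedConv S μ f g))
      = ρ.integrated μ (twistedConv S μ (starCc S g) (starCc S f)) := by
  obtain ⟨h, hh, hπ, hU⟩ := hρ
  have hf := inner_integrated μ hh hπ hU
  refine ContinuousLinearMap.ext fun y => ext_inner_left 𝕜 fun v => ?_
  rw [← hf, integrated_conv, integrated_conv]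
  change h.inner (ρ.integrated μ f (ρ.integrated μ g v)) y = h.inner v _
  rw [hf, hf]
  rfl

theorem integrated_starCc_starCc (μ : Measure G) [μ.IsHaarMeasure] (hρ : ρ.IsInvolutive)
    (f : C_c(G, A)) : ρ.integrated μ (starCc S (starCc S f)) = ρ.integrated μ f := by
  obtain ⟨h, hh, hπ, hU⟩ := hρ
  have hf := inner_integrated μ hh hπ hU
  refine ContinuousLinearMap.ext fun y => ext_inner_left 𝕜 fun v => ?_
  rw [← hf, ← h.conj_inner_symm, ← hf, h.conj_inner_symm]

end CovRep

/-! ## The involution on the crossed product -/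

namespace UniformlyBoundedClass

variable {R : UniformlyBoundedClass.{u, v} S} {μ : Measure G} [μ.IsHaarMeasure]

/-- The representations in `𝓡` separate the image of `q^𝓡`. Identities for the involution can thus
be checked on adjoint operators instead of by manipulating convolution integrals. -/
theorem q_eq_q {f g : C_c(G, A)} (h : ∀ ρ ∈ R.carrier, ρ.2.integrated μ f = ρ.2.integrated μ g) :
    R.q μ f = R.q μ g := by
  rw [← sub_eq_zero, ← q_sub, ← norm_le_zero_iff, norm_q]
  refine R.sigma_le_of_forall μ fun ρ hρ => ?_
  rw [sub_eq_add_neg, ← neg_one_smul 𝕜 g, CovRep.integrated_add, CovRep.integrated_smul, h ρ hρ]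
  simp

theorem exists_starRing (hR : ∀ p ∈ R.carrier, p.2.IsInvolutive) :
    ∃ (_ : StarRing (R.CrossedProduct μ)) (_ : StarModule 𝕜 (R.CrossedProduct μ))
      (_ : CStarRing (R.CrossedProduct μ)), ∀ f, star (R.q μ f) = R.q μ (starCc S f) := by
  have hbound : ∀ f, ‖R.q μ (starCc S f)‖ ≤ 1 * R.sigma μ f := fun f => by
    rw [one_mul, norm_q]
    exact R.sigma_le_of_forall μ fun ρ hρ => (ρ.2.norm_integrated_starCc_le μ (hR ρ hρ) f).trans
      (R.norm_integrated_le_sigma μ f ⟨ρ, hρ⟩)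
  let starL : CcAlgebra μ R →L⋆[𝕜] R.CrossedProduct μ := LinearMap.mkContinuous
    { toFun := fun f : C_c(G, A) => R.q μ (starCc S f)
      map_add' := fun f g => (congrArg (R.q μ) (starCc_add f g)).trans (map_add (R.qₗ μ) _ _)
      map_smul' := fun c f => (congrArg (R.q μ) (starCc_smul c f)).trans
        (map_smul (R.qₗ μ) (star c) _) } 1 hbound
  let st : R.CrossedProduct μ →L⋆[𝕜] R.CrossedProduct μ :=
    starL.extend (CrossedProduct.incl R μ)
  have hst : ∀ f, st (R.q μ f) = R.q μ (starCc S f) := fun f =>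
    ContinuousLinearMap.extend_eq _ (CrossedProduct.denseRange_incl R μ)
      (CrossedProduct.isUniformInducing_incl R μ) (toCc R μ f)
  have st_st : ∀ c, st (st c) = c := fun c =>
    induction_q c (isClosed_eq (by fun_prop) continuous_id) fun f => by
      rw [hst, hst]
      exact q_eq_q fun ρ hρ => ρ.2.integrated_starCc_starCc μ (hR ρ hρ) f
  have st_mul : ∀ c d, st (c * d) = st d * st c := fun c d => by
    refine induction_q c (isClosed_eq (by fun_prop) (by fun_prop)) fun f => ?_
    refine induction_q d (isClosed_eq (by fun_prop) (by fun_prop)) fun g => ?_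
    rw [← q_conv, hst, hst, hst, ← q_conv]
    exact q_eq_q fun ρ hρ => ρ.2.integrated_starCc_conv μ (hR ρ hρ) f g
  have st_norm : ∀ c, ‖c‖ * ‖c‖ ≤ ‖st c * c‖ := fun c => by
    refine induction_q c (isClosed_le (by fun_prop) (by fun_prop)) fun f => ?_
    rw [hst, ← q_conv, norm_q, norm_q, ← sq]
    -- The operator inequality `‖T‖² ≤ ‖T* T‖` is put in square root form so that the supremum over
    -- `𝓡` can be taken on the left.
    have h1 : R.sigma μ f ≤ √(R.sigma μ (twistedConv S μ (starCc S f) f)) :=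
      R.sigma_le_of_forall μ fun ρ hρ => Real.le_sqrt_of_sq_le
        ((ρ.2.sq_norm_integrated_le μ (hR ρ hρ) f).trans
          (R.norm_integrated_le_sigma μ _ ⟨ρ, hρ⟩))
    calc R.sigma μ f ^ 2 ≤ √(R.sigma μ (twistedConv S μ (starCc S f) f)) ^ 2 := by
          gcongr; exact R.sigma_nonneg μ f
      _ = _ := Real.sq_sqrt (R.sigma_nonneg μ _)
  let i₁ : StarRing (R.CrossedProduct μ) :=
    { star := st
      star_involutive := st_st
      star_mul := st_mul
      star_add := map_add st }
  exact ⟨i₁, ⟨fun c a => map_smulₛₗ st c a⟩, ⟨fun {c} => st_norm c⟩, hst⟩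

end UniformlyBoundedClass

theorem CovRep.isInvolutive_iff {R : UniformlyBoundedClass.{u, v} S} {μ : Measure G}
    [μ.IsHaarMeasure] [StarRing (R.CrossedProduct μ)] [ContinuousStar (R.CrossedProduct μ)]
    (hstar : ∀ f, star (R.q μ f) = R.q μ (starCc S f)) {X : BanachSpace.{u, w} 𝕜}
    {ρ : CovRep S X} (h : ρ.IsRContinuous μ R) (hρ : ρ.IsNonDegenerate) :
    ρ.IsInvolutive ↔ (ρ.integration h).IsInvolutive := by
  constructor
  · rintro ⟨i, hi, hπ, hU⟩
    refine ⟨i, hi, fun c x y => ?_⟩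
    obtain ⟨L, hL⟩ := exists_inner_clm hi x
    obtain ⟨L', hL'⟩ := exists_inner_clm hi y
    rw [← hL, ← i.conj_inner_symm, ← hL']
    refine UniformlyBoundedClass.induction_q c (isClosed_eq ?_ ?_) fun f => ?_
    · exact RCLike.continuous_conj.comp (by fun_prop)
    · exact L.continuous.comp (((ρ.integration h).T.continuous.comp continuous_star).clm_apply
        continuous_const)
    · rw [hstar, integration_q, integration_q, hL, hL', i.conj_inner_symm]
      exact inner_integrated μ hi hπ hU f x y
  · rintro ⟨i, hi, hT⟩
    refine ⟨i, hi, inner_of_integrated μ hρ hi fun f x y => ?_⟩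
    have := hT (R.q μ f) x y
    rwa [hstar, integration_q, integration_q] at this

end Star

end Involutive

end

end CrossedProd

/-! ### The main theorem -/

theorem theoremt {𝕜 : Type*} [RCLike 𝕜]
    {A : Type*} [NonUnitalNormedRing A] [NormedSpace 𝕜 A] [IsScalarTower 𝕜 A A]
    [SMulCommClass 𝕜 A A] [CompleteSpace A] [NormedSpace ℝ A] [IsScalarTower ℝ 𝕜 A]
    {G : Type*} [Group G] [TopologicalSpace G] [IsTopologicalGroup G] [LocallyCompactSpace G]
    [T2Space G] [MeasurableSpace G] [BorelSpace G]
    (μ : Measure G) [μ.IsHaarMeasure] [μ.Regular]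
    (S : CrossedProd.DynSystem 𝕜 A G) (hA : CrossedProd.HasBoundedApproxLeftIdentity A)
    (R : CrossedProd.UniformlyBoundedClass S)
    (hR : ∀ p ∈ R.carrier, p.2.IsNonDegenerate)
    (D : ℝ) (hD : 0 ≤ D) (hν : ∀ r, R.nu r ≤ D)
    (C₁ : ℝ) (hC₁ : 0 ≤ C₁) (hL : ∀ f : C_c(G, A), ∫ s, ‖f s‖ ∂μ ≤ C₁ * R.sigma μ f)
    (𝒳 : Set (CrossedProd.BanachSpace 𝕜)) :
    -- the covariant representations in question are `𝓡`-continuous, so that `(π ⋊ U)^𝓡` is defined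
    (∀ X ∈ 𝒳, ∀ ρ : CrossedProd.CovRep S X,
      ρ.IsNonDegenerate → ρ.IsUniformlyBounded → ρ.IsRContinuous μ R) ∧
    -- the bijection
    Set.BijOn (CrossedProd.integrationMap μ R)
      {p | p.1 ∈ 𝒳 ∧ p.2.1.IsNonDegenerate ∧ p.2.1.IsUniformlyBounded}
      {t | t.1 ∈ 𝒳 ∧ t.2.IsNonDegenerate} ∧
    -- closed invariant subspaces
    (∀ X ∈ 𝒳, ∀ (ρ : CrossedProd.CovRep S X) (h : ρ.IsRContinuous μ R),
      ρ.IsNonDegenerate → ρ.IsUniformlyBounded →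
      ∀ Y : Submodule 𝕜 X, IsClosed (Y : Set X) →
        (ρ.IsInvariant Y ↔ (ρ.integration h).IsInvariant Y)) ∧
    -- bounded intertwining operators
    (∀ X ∈ 𝒳, ∀ X' ∈ 𝒳, ∀ (ρ : CrossedProd.CovRep S X) (ρ' : CrossedProd.CovRep S X')
      (h : ρ.IsRContinuous μ R) (h' : ρ'.IsRContinuous μ R),
      ρ.IsNonDegenerate → ρ.IsUniformlyBounded → ρ'.IsNonDegenerate → ρ'.IsUniformlyBounded →
      ∀ Φ : X →L[𝕜] X',
        (ρ.Intertwines ρ' Φ ↔ (ρ.integration h).Intertwines (ρ'.integration h') Φ)) ∧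
    -- the crossed product is isomorphic to `L¹(G, A)` with twisted convolution
    (∃ Ψ : Lp A 1 μ ≃L[𝕜] R.CrossedProduct μ,
      (∀ f : C_c(G, A),
        Ψ ((f.continuous.memLp_of_hasCompactSupport f.hasCompactSupport).toLp f) = R.q μ f) ∧
      ∀ F H : Lp A 1 μ,
        (∀ᵐ s ∂μ, Integrable (fun r => F r * S.act r (H (r⁻¹ * s))) μ) ∧
        Ψ.symm (Ψ F * Ψ H) =ᵐ[μ] CrossedProd.twistedConvFun S μ F H) ∧
    -- the involutive case: the crossed product is a `C*`-algebra with `q(f)* = q(f*)`, and the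
    -- bijection preserves the property of being involutive
    (∀ [StarRing A] [StarModule 𝕜 A] [ContinuousStar A],
      (∀ s a, S.act s (star a) = star (S.act s a)) →
      (∀ p ∈ R.carrier, p.2.IsInvolutive) →
      ∃ (_ : StarRing (R.CrossedProduct μ)) (_ : StarModule 𝕜 (R.CrossedProduct μ))
        (_ : CStarRing (R.CrossedProduct μ)),
        (∀ f : C_c(G, A), star (R.q μ f) = R.q μ (CrossedProd.starCc S f)) ∧
        ∀ X ∈ 𝒳, ∀ (ρ : CrossedProd.CovRep S X) (h : ρ.IsRContinuous μ R),
          ρ.IsNonDegenerate → ρ.IsUniformlyBounded →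
          (ρ.IsInvolutive ↔ (ρ.integration h).IsInvolutive)) := by
  have hL' : ∃ K : ℝ, ∀ f : C_c(G, A), ∫ s, ‖f s‖ ∂μ ≤ K * R.sigma μ f := ⟨C₁, hL⟩
  obtain ⟨K, -, hK⟩ := R.exists_sigma_le μ hD hν
  refine ⟨fun X _ ρ _ hρ => ρ.isRContinuous hL' hρ, CrossedProd.bijOn_integrationMap hA hD hν hL' 𝒳,
    fun X _ ρ h hρ _ Y hY => ρ.isInvariant_iff hA hρ h hY,
    fun X _ X' _ ρ ρ' h h' hρ _ hρ' _ Φ => ρ.intertwines_iff hA hρ hρ' h h' Φ,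
    ⟨R.lOneEquiv μ ⟨K, hK⟩ hL', R.lOneEquiv_toLOne ⟨K, hK⟩ hL',
      CrossedProd.lOneEquiv_symm_mul R μ hD hν hC₁ hL _ (R.lOneEquiv_toLOne ⟨K, hK⟩ hL')⟩, ?_⟩
  intro _ _ _ _ hinv
  obtain ⟨i₁, i₂, i₃, hstar⟩ := R.exists_starRing (μ := μ) hinv
  exact ⟨i₁, i₂, i₃, hstar, fun X _ ρ h hρ _ => CrossedProd.CovRep.isInvolutive_iff hstar h hρ⟩
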